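/- Let $n\ge 2$ and $\kappa>1$, and write $B_r=\{x\in\mathbb R^n:|x|<r\}$. There exist $\tau_0>0$ and $C>0$, depending only on $n$ and $\kappa$, such that the following holds for all real $\tau\ge\tau_0$ and $k\ge 1$. Let $q\in C^1(\mathbb R^n)$ be real-valued with $\kappa^{-1}\le q\le\kappa$ and $\nabla q(x)\cdot x\ge 0$ for all $x\in\mathbb R^n$. Let $f,F^1,\dots,F^n\in L^2(\mathbb R^n)$ be real-valued with supports contained in $B_2\setminus\overline{B_1}$. Let $u\in H^1(\mathbb R^n)$ be real-valued, with compact support contained in $B_2\setminus\overline{B_1}$, and a weak solution of $$(\Delta+k^2q)u=f+\sum_{j=1}^n\partial_jF^j\quad\text{in }\mathbb R^n.$$ Then, with $\phi(x)=\tau\log|x|$, $$\tau\|e^{\phi}u\|_{L^2(\mathbb R^n)}+\|e^{\phi}|x|\nabla u\|_{L^2(\mathbb R^n)}+\tau^{1/2}k\,\|q^{1/2}|x|e^{\phi}u\|_{L^2(\mathbb R^n)}\le C\Big(\|e^{\phi}|x|^2f\|_{L^2(\mathbb R^n)}+\max\{\tau,k\}\sum_{j=1}^n\|e^{\phi}|x|F^j\|_{L^2(\mathbb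 R^n)}\Big).$$ -/

import Mathlib

open MeasureTheory
open scoped ContDiff

/-- Euclidean space `ℝⁿ`. -/
abbrev RSpace (n : ℕ) : Type := EuclideanSpace ℝ (Fin n)

/-- The open annulus `B₂ ∖ closure B₁`. -/
def annulus (n : ℕ) : Set (RSpace n) := {x | 1 < ‖x‖ ∧ ‖x‖ < 2}

/-- The support of (the a.e. class of) `u` is a compact subset of the open set `U`. -/
def CompactlySupportedIn {n : ℕ} (u : RSpace n → ℝ) (U : Set (RSpace n)) : Prop :=
  ∃ K : Set (RSpace n), IsCompact K ∧ K ⊆ U ∧ ∀ᵐ x ∂(volume : Measure (RSpace n)), x ∉ K → u x = 0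

/-- Smooth compactly supported test functions on `ℝⁿ`. -/
def IsTestFunction {n : ℕ} (η : RSpace n → ℝ) : Prop :=
  ContDiff ℝ ∞ η ∧ HasCompactSupport η

/-- The partial derivative `∂ⱼ η`. -/
noncomputable def partialDeriv {n : ℕ} (j : Fin n) (η : RSpace n → ℝ) (x : RSpace n) : ℝ :=
  fderiv ℝ η x (EuclideanSpace.single j 1)

/-- `u` belongs to `H¹(ℝⁿ)` and `G` is its weak gradient. -/
structure IsH1WithGradient {n : ℕ} (u : RSpace n → ℝ) (G : RSpace n → RSpace n) : Prop where
  memLp : MemLp u 2 volume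
  memLp_gradient : MemLp G 2 volume
  weak_gradient : ∀ η : RSpace n → ℝ, IsTestFunction η → ∀ j : Fin n,
    ∫ x, u x * partialDeriv j η x = -∫ x, G x j * η x

/-- The function `u` with weak gradient `G` is a weak solution of
`(Δ + k² q) u = f + ∑ⱼ ∂ⱼ Fʲ` in `ℝⁿ`. -/
def IsWeakSolution {n : ℕ} (k : ℝ) (q : RSpace n → ℝ) (f : RSpace n → ℝ)
    (F : Fin n → RSpace n → ℝ) (u : RSpace n → ℝ) (G : RSpace n → RSpace n) : Prop :=
  ∀ η : RSpace n → ℝ, IsTestFunction η →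
    -(∑ j, ∫ x, G x j * partialDeriv j η x) + k ^ 2 * ∫ x, q x * u x * η x
      = (∫ x, f x * η x) - ∑ j, ∫ x, F j x * partialDeriv j η x

/-- `q ∈ C¹(ℝⁿ)`, `κ⁻¹ ≤ q ≤ κ` and `∇q · x ≥ 0` everywhere in `ℝⁿ`. -/
structure IsAdmissibleCoefficient {n : ℕ} (κ : ℝ) (q : RSpace n → ℝ) : Prop where
  contDiff : ContDiff ℝ 1 q
  lower : ∀ x, κ⁻¹ ≤ q x
  upper : ∀ x, q x ≤ κ
  radially_monotone : ∀ x, 0 ≤ fderiv ℝ q x x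

/-- The weight `φ(x) = τ log |x|`. -/
noncomputable def carlemanWeight {n : ℕ} (τ : ℝ) (x : RSpace n) : ℝ := τ * Real.log ‖x‖

/-! ### Coordinate calculus on Euclidean space and the divergence theorem. -/

section PartialDerivatives

variable {n : ℕ}

/-! Put `v = e^φ u`. After multiplication by `|x|²` the conjugated operator becomes `P = |x|²Δ − 2τ
x·∇ + τ(τ+2−n) + k²|x|²q`, and the natural multiplier is `S = x·∇ + n/2`, the skew generator of
dilations. Integration by parts gives `−∫ Pv Sv = (2τ+2) ∫ (Sv)² + (k²/2) ∫ x·∇(|x|²q) v²`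
(`integral_conjugatedOperator_mul_skewEuler`). Radial monotonicity of `q` gives `x·∇(|x|²q) ≥
2|x|²q`, so both terms on the right have a sign, and Cauchy–Schwarz bounds `τ²‖Sv‖² +
τk²‖q^{1/2}|x|v‖²` by `‖Pv‖²`. On functions supported in `1/2 ≤ |x| ≤ 4` the operator `S` controls
`v` itself, and pairing `Pv` with `v` recovers the gradient. The outcome is `carleman_smooth`.

A source `div F` cannot be placed in `L²` directly. With `H = e^φ F` and `M = max(τ,k)`, one solves
`(Δ − M²) w = div H`; the energy estimate is `M²‖w‖² + ‖∇w‖² ≤ ‖H‖²`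
(`exists_resolvent_divergence`). Subtracting `χw`, with `χ` a cutoff equal to 1 where `H` lives,
removes the divergence. What remains in `P(v − χw)` contains at most `M²w` and `M∇w`, hence costs
`M‖H‖`, which is the factor `max(τ,k)` of the theorem. The enlarged annulus in `carleman_smooth`
leaves room for `χw`. This gives `carleman_smooth_divergence`.

Weak solutions are treated by mollification. The mollified equation has the error `k²(ρ*(qu) −
q(ρ*u))`, which is small because `q` is uniformly continuous on compact sets. At a scale depending
on `τ`, averaging increases the weighted norms of `f` and `F` by a factor of at most 2, so the
constant stays uniform (`exists_smoothCarlemanBound_mollify_le`). Fatou's lemma then passes the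
estimate to `u` and its weak gradient. -/

theorem partialDeriv_mul {f g : RSpace n → ℝ} {x : RSpace n} (hf : DifferentiableAt ℝ f x)
    (hg : DifferentiableAt ℝ g x) (j : Fin n) :
    partialDeriv j (fun y => f y * g y) x
      = f x * partialDeriv j g x + partialDeriv j f x * g x := by
  simp only [partialDeriv]
  rw [fderiv_fun_mul hf hg]
  simp [mul_comm]

theorem partialDeriv_add {f g : RSpace n → ℝ} {x : RSpace n} (hf : DifferentiableAt ℝ f x)
    (hg : DifferentiableAt ℝ g x) (j : Fin n) :
    partialDeriv j (fun y => f y + g y) x = partialDeriv j f x + partialDeriv j g x := by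
  simp only [partialDeriv]
  rw [fderiv_fun_add hf hg]
  simp

theorem partialDeriv_sub {f g : RSpace n → ℝ} {x : RSpace n} (hf : DifferentiableAt ℝ f x)
    (hg : DifferentiableAt ℝ g x) (j : Fin n) :
    partialDeriv j (fun y => f y - g y) x = partialDeriv j f x - partialDeriv j g x := by
  simp only [partialDeriv]
  rw [fderiv_fun_sub hf hg]
  simp

theorem partialDeriv_const_mul {f : RSpace n → ℝ} {x : RSpace n} (hf : DifferentiableAt ℝ f x)
    (c : ℝ) (j : Fin n) :
    partialDeriv j (fun y => c * f y) x = c * partialDeriv j f x := by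
  simp only [partialDeriv]
  rw [fderiv_const_mul hf]
  simp

theorem partialDeriv_sum {ι : Type*} (s : Finset ι) {f : ι → RSpace n → ℝ} {x : RSpace n}
    (hf : ∀ i ∈ s, DifferentiableAt ℝ (f i) x) (j : Fin n) :
    partialDeriv j (fun y => ∑ i ∈ s, f i y) x = ∑ i ∈ s, partialDeriv j (f i) x := by
  simp only [partialDeriv]
  rw [fderiv_fun_sum hf]
  simp

theorem partialDeriv_sq {f : RSpace n → ℝ} {x : RSpace n} (hf : DifferentiableAt ℝ f x)
    (j : Fin n) : partialDeriv j (fun y => f y ^ 2) x = 2 * f x * partialDeriv j f x := by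
  simp only [pow_two]
  rw [partialDeriv_mul hf hf]
  ring

theorem partialDeriv_coord (j l : Fin n) (x : RSpace n) :
    partialDeriv j (fun y : RSpace n => y l) x = if l = j then 1 else 0 := by
  have h : fderiv ℝ (fun y : RSpace n => y l) x = EuclideanSpace.proj l :=
    (EuclideanSpace.proj (𝕜 := ℝ) l).hasFDerivAt.fderiv
  simp only [partialDeriv, h]
  simp

theorem partialDeriv_norm_sq (j : Fin n) (x : RSpace n) :
    partialDeriv j (fun y : RSpace n => ‖y‖ ^ 2) x = 2 * x j := by
  have h := (hasStrictFDerivAt_norm_sq x).hasFDerivAt.fderiv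
  simp only [partialDeriv, h]
  simp [EuclideanSpace.inner_single_right]

theorem contDiff_partialDeriv {f : RSpace n → ℝ} (hf : ContDiff ℝ ∞ f) (j : Fin n) :
    ContDiff ℝ ∞ (partialDeriv j f) := by
  unfold partialDeriv
  exact (hf.fderiv_right (m := ∞) (by simp)).clm_apply contDiff_const

theorem continuous_partialDeriv {f : RSpace n → ℝ} (hf : ContDiff ℝ 1 f) (j : Fin n) :
    Continuous (partialDeriv j f) := by
  unfold partialDeriv
  exact (hf.continuous_fderiv (by simp)).clm_apply continuous_const

theorem HasCompactSupport.partialDeriv {f : RSpace n → ℝ} (hf : HasCompactSupport f)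
    (j : Fin n) : HasCompactSupport (partialDeriv j f) :=
  hf.fderiv_apply ℝ _

theorem partialDeriv_comm {f : RSpace n → ℝ} (hf : ContDiff ℝ ∞ f) (j l : Fin n)
    (x : RSpace n) :
    partialDeriv j (partialDeriv l f) x = partialDeriv l (partialDeriv j f) x := by
  have hs : IsSymmSndFDerivAt ℝ f x := hf.contDiffAt.isSymmSndFDerivAt (by simp [minSmoothness_of_isRCLikeNormedField]; exact WithTop.coe_le_coe.2 le_top)
  have h1 : DifferentiableAt ℝ (fderiv ℝ f) x :=
    ((hf.fderiv_right (m := ∞) (by simp)).differentiable (by simp)) x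
  have key : ∀ a b : Fin n, _root_.partialDeriv a (_root_.partialDeriv b f) x
      = fderiv ℝ (fderiv ℝ f) x (EuclideanSpace.single a 1) (EuclideanSpace.single b 1) := by
    intro a b
    unfold _root_.partialDeriv
    rw [fderiv_clm_apply h1 (by fun_prop)]
    simp
  rw [key, key, hs]

theorem euclidean_eq_sum_single (x : RSpace n) :
    x = ∑ j, x j • EuclideanSpace.single j (1 : ℝ) := by
  ext i
  simp [Pi.single_apply]

theorem clm_apply_eq_sum (A : RSpace n →L[ℝ] ℝ) (x : RSpace n) :
    A x = ∑ j, x j * A (EuclideanSpace.single j 1) := by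
  conv_lhs => rw [euclidean_eq_sum_single x]
  simp [map_sum]

theorem fderiv_self_eq_sum (f : RSpace n → ℝ) (x : RSpace n) :
    fderiv ℝ f x x = ∑ j, x j * partialDeriv j f x :=
  clm_apply_eq_sum _ _

theorem integral_partialDeriv_eq_zero {f : RSpace n → ℝ} (hf : ContDiff ℝ 1 f)
    (hc : HasCompactSupport f) (j : Fin n) : ∫ x, partialDeriv j f x = 0 := by
  have hi : Integrable f := hf.continuous.integrable_of_hasCompactSupport hc
  have hi' : Integrable (partialDeriv j f) :=
    (continuous_partialDeriv hf j).integrable_of_hasCompactSupport (hc.partialDeriv j)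
  have := integral_mul_fderiv_eq_neg_fderiv_mul_of_integrable (𝕜 := ℝ)
    (f := fun _ : RSpace n => (1 : ℝ)) (g := f) (v := EuclideanSpace.single j (1 : ℝ))
    (μ := volume) (by simp) (by simp only [one_mul]; exact hi') (by simpa using hi)
    (fun x _ => by fun_prop) (fun x _ => hf.differentiable (by simp) x)
  simpa [partialDeriv] using this

theorem integral_divergence_eq_zero {Y : Fin n → RSpace n → ℝ} (hY : ∀ j, ContDiff ℝ 1 (Y j))
    (hc : ∀ j, HasCompactSupport (Y j)) : ∫ x, ∑ j, partialDeriv j (Y j) x = 0 := by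
  rw [integral_finsetSum]
  · simp [integral_partialDeriv_eq_zero (hY _) (hc _)]
  · intro j _
    exact (continuous_partialDeriv (hY j) j).integrable_of_hasCompactSupport
      ((hc j).partialDeriv j)

/-- The Laplacian as the sum of the second partial derivatives. -/
noncomputable def lap (f : RSpace n → ℝ) (x : RSpace n) : ℝ :=
  ∑ j, partialDeriv j (partialDeriv j f) x

/-- The square of the length of the gradient. -/
noncomputable def gradSq (f : RSpace n → ℝ) (x : RSpace n) : ℝ :=
  ∑ j, partialDeriv j f x ^ 2

/-- The Euler operator `x · ∇`. -/
noncomputable def euler (f : RSpace n → ℝ) (x : RSpace n) : ℝ :=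
  ∑ j, x j * partialDeriv j f x

/-- The skew-symmetric operator `x · ∇ + n / 2`. -/
noncomputable def skewEuler (f : RSpace n → ℝ) (x : RSpace n) : ℝ :=
  euler f x + n / 2 * f x

theorem contDiff_coord (j : Fin n) {m : WithTop ℕ∞} : ContDiff ℝ m (fun x : RSpace n => x j) :=
  (EuclideanSpace.proj (𝕜 := ℝ) j).contDiff

theorem contDiff_lap {f : RSpace n → ℝ} (hf : ContDiff ℝ ∞ f) : ContDiff ℝ ∞ (lap f) :=
  ContDiff.sum fun j _ => contDiff_partialDeriv (contDiff_partialDeriv hf j) j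

theorem contDiff_gradSq {f : RSpace n → ℝ} (hf : ContDiff ℝ ∞ f) : ContDiff ℝ ∞ (gradSq f) :=
  ContDiff.sum fun j _ => (contDiff_partialDeriv hf j).pow 2

theorem contDiff_euler {f : RSpace n → ℝ} (hf : ContDiff ℝ ∞ f) : ContDiff ℝ ∞ (euler f) :=
  ContDiff.sum fun j _ => (contDiff_coord j).mul (contDiff_partialDeriv hf j)

theorem contDiff_skewEuler {f : RSpace n → ℝ} (hf : ContDiff ℝ ∞ f) :
    ContDiff ℝ ∞ (skewEuler f) :=
  (contDiff_euler hf).add (contDiff_const.mul hf)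

theorem norm_sq_eq_sum (x : RSpace n) : ‖x‖ ^ 2 = ∑ j, x j ^ 2 := by
  simp [EuclideanSpace.norm_sq_eq]

theorem partialDeriv_eq_zero_of_notMem_tsupport {f : RSpace n → ℝ} {x : RSpace n}
    (hx : x ∉ tsupport f) (j : Fin n) : partialDeriv j f x = 0 := by
  simp [partialDeriv, fderiv_of_notMem_tsupport (𝕜 := ℝ) hx]

end PartialDerivatives

/-! ### Integral identities from explicit divergences. -/

section Identities

variable {n : ℕ} {v : RSpace n → ℝ}

theorem hasCompactSupport_finset_sum {ι : Type*} (s : Finset ι) {f : ι → RSpace n → ℝ}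
    (hf : ∀ i, HasCompactSupport (f i)) : HasCompactSupport (fun x => ∑ i ∈ s, f i x) := by
  classical
  induction s using Finset.induction_on with
  | empty => exact HasCompactSupport.zero
  | insert a s ha ih =>
    simp only [Finset.sum_insert ha]
    exact (hf a).add ih

theorem HasCompactSupport.lap (hc : HasCompactSupport v) : HasCompactSupport (lap v) :=
  hasCompactSupport_finset_sum _ fun j => (hc.partialDeriv j).partialDeriv j

theorem HasCompactSupport.euler (hc : HasCompactSupport v) : HasCompactSupport (euler v) :=
  hasCompactSupport_finset_sum _ fun j => (hc.partialDeriv j).mul_left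

theorem HasCompactSupport.gradSq (hc : HasCompactSupport v) : HasCompactSupport (gradSq v) :=
  hasCompactSupport_finset_sum _ fun j => by
    simp only [pow_two]
    exact (hc.partialDeriv j).mul_left

theorem HasCompactSupport.skewEuler (hc : HasCompactSupport v) :
    HasCompactSupport (skewEuler v) :=
  hc.euler.add hc.mul_left

/-- The integrand is the divergence of `|x|² v ∇v − v² x`; the correction `−v² x` cancels the cross
term `2v x·∇v`. -/
theorem integral_norm_sq_lap_mul_self (hv : ContDiff ℝ ∞ v) (hc : HasCompactSupport v) :
    ∫ x, (‖x‖ ^ 2 * lap v x * v x + ‖x‖ ^ 2 * gradSq v x - n * v x ^ 2) = 0 := by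
  have hN : ContDiff ℝ ∞ (fun x : RSpace n => ‖x‖ ^ 2) := contDiff_norm_sq ℝ
  have h1 := fun j => contDiff_partialDeriv hv j
  have hX := fun j => contDiff_coord (n := n) j (m := ∞)
  have d : ∀ {g : RSpace n → ℝ}, ContDiff ℝ ∞ g → ∀ x, DifferentiableAt ℝ g x :=
    fun hg x => hg.differentiable (by simp) x
  have key := integral_divergence_eq_zero (n := n)
    (Y := fun j x => (‖x‖ ^ 2 * partialDeriv j v x) * v x - x j * v x ^ 2)
    (fun j => (((hN.mul (h1 j)).mul hv).sub ((hX j).mul (hv.pow 2))).of_le (by simp))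
    (fun j => by
      have e : (fun x => (‖x‖ ^ 2 * partialDeriv j v x) * v x - x j * v x ^ 2)
        = fun x => (‖x‖ ^ 2 * partialDeriv j v x - x j * v x) * v x := by
          funext x; ring
      rw [e]
      exact hc.mul_left)
  rw [← key]
  congr 1
  funext x
  have e : ∀ j, partialDeriv j
      (fun x => (‖x‖ ^ 2 * partialDeriv j v x) * v x - x j * v x ^ 2) x
      = ‖x‖ ^ 2 * v x * partialDeriv j (partialDeriv j v) x
        + ‖x‖ ^ 2 * partialDeriv j v x ^ 2 - v x ^ 2 := by
    intro j
    rw [partialDeriv_sub (d ((hN.mul (h1 j)).mul hv) x) (d ((hX j).mul (hv.pow 2)) x),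
      partialDeriv_mul (d (hN.mul (h1 j)) x) (d hv x),
      partialDeriv_mul (d hN x) (d (h1 j) x), partialDeriv_mul (d (hX j) x) (d (hv.pow 2) x),
      partialDeriv_sq (d hv x), partialDeriv_norm_sq, partialDeriv_coord]
    simp only [if_true]
    ring
  simp only [e, Finset.sum_sub_distrib, Finset.sum_add_distrib, ← Finset.mul_sum, lap, gradSq]
  simp
  ring

/-- The integrand is the divergence of `½ V v² x`. The case `V = 1` expresses that `skewEuler` is
skew; a radially increasing `V` gives positivity. -/
theorem integral_weight_mul_skewEuler {V : RSpace n → ℝ} (hV : ContDiff ℝ 1 V)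
    (hv : ContDiff ℝ ∞ v) (hc : HasCompactSupport v) :
    ∫ x, (V x * v x * skewEuler v x + 1 / 2 * euler V x * v x ^ 2) = 0 := by
  have hv1 : ContDiff ℝ 1 v := hv.of_le (by simp)
  have hX := fun j => contDiff_coord (n := n) j (m := 1)
  have d : ∀ {g : RSpace n → ℝ}, ContDiff ℝ 1 g → ∀ x, DifferentiableAt ℝ g x :=
    fun hg x => hg.differentiable (by simp) x
  have key := integral_divergence_eq_zero (n := n)
    (Y := fun j x => x j * (1 / 2 * (V x * v x ^ 2)))
    (fun j => (hX j).mul (contDiff_const.mul (hV.mul (hv1.pow 2))))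
    (fun j => by
      have e : (fun x : RSpace n => x j * (1 / 2 * (V x * v x ^ 2)))
        = fun x => (x j * (1 / 2 * (V x * v x))) * v x := by
          funext x; ring
      rw [e]
      exact hc.mul_left)
  rw [← key]
  congr 1
  funext x
  have e : ∀ j, partialDeriv j (fun x => x j * (1 / 2 * (V x * v x ^ 2))) x
      = V x * v x * (x j * partialDeriv j v x) + 1 / 2 * v x ^ 2 * (x j * partialDeriv j V x)
        + 1 / 2 * V x * v x ^ 2 := by
    intro j
    rw [partialDeriv_mul (d (hX j) x) (d (contDiff_const.mul (hV.mul (hv1.pow 2))) x),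
      partialDeriv_const_mul (d (hV.mul (hv1.pow 2)) x),
      partialDeriv_mul (d hV x) (d (hv1.pow 2) x),
      partialDeriv_sq (d hv1 x), partialDeriv_coord]
    simp only [if_true]
    ring
  simp only [e, Finset.sum_add_distrib, ← Finset.mul_sum, skewEuler, euler]
  simp
  ring

/-- A Rellich–Pohozaev identity: the integrand is the divergence of `|x|² (x·∇v) ∇v − ½ |x|² |∇v|²
x`. The second derivatives other than the Laplacian cancel by symmetry of the Hessian. -/
theorem integral_norm_sq_lap_mul_euler (hv : ContDiff ℝ ∞ v) (hc : HasCompactSupport v) :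
    ∫ x, (‖x‖ ^ 2 * lap v x * euler v x + 2 * euler v x ^ 2 - n / 2 * (‖x‖ ^ 2 * gradSq v x))
      = 0 := by
  have hN : ContDiff ℝ ∞ (fun x : RSpace n => ‖x‖ ^ 2) := contDiff_norm_sq ℝ
  have h1 := fun j => contDiff_partialDeriv hv j
  have hX := fun j => contDiff_coord (n := n) j (m := ∞)
  have hE := contDiff_euler hv
  have hG := contDiff_gradSq hv
  have d : ∀ {g : RSpace n → ℝ}, ContDiff ℝ ∞ g → ∀ x, DifferentiableAt ℝ g x :=
    fun hg x => hg.differentiable (by simp) x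
  have key := integral_divergence_eq_zero (n := n)
    (Y := fun j x => (‖x‖ ^ 2 * partialDeriv j v x) * euler v x
      - x j * (1 / 2 * (‖x‖ ^ 2 * gradSq v x)))
    (fun j => (((hN.mul (h1 j)).mul hE).sub
      ((hX j).mul (contDiff_const.mul (hN.mul hG)))).of_le (by simp))
    (fun j => (hc.euler.mul_left).sub (hc.gradSq.mul_left.mul_left.mul_left))
  rw [← key]
  congr 1
  funext x
  have eE : ∀ j, partialDeriv j (euler v) x
      = partialDeriv j v x + ∑ l, x l * partialDeriv j (partialDeriv l v) x := by
    intro j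
    have : euler v = fun x => ∑ l, x l * partialDeriv l v x := rfl
    rw [this, partialDeriv_sum _ (fun l _ => d ((hX l).mul (h1 l)) x)]
    simp only [partialDeriv_mul (d (hX _) x) (d (h1 _) x), partialDeriv_coord,
      Finset.sum_add_distrib]
    simp [add_comm]
  have eG : ∀ j, partialDeriv j (gradSq v) x
      = ∑ l, 2 * partialDeriv l v x * partialDeriv j (partialDeriv l v) x := by
    intro j
    have : gradSq v = fun x => ∑ l, partialDeriv l v x ^ 2 := rfl
    rw [this, partialDeriv_sum _ (fun l _ => d ((h1 l).pow 2) x)]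
    simp only [partialDeriv_sq (d (h1 _) x)]
  have e : ∀ j, partialDeriv j
      (fun x => (‖x‖ ^ 2 * partialDeriv j v x) * euler v x
        - x j * (1 / 2 * (‖x‖ ^ 2 * gradSq v x))) x
      = ‖x‖ ^ 2 * euler v x * partialDeriv j (partialDeriv j v) x
        + 2 * euler v x * (x j * partialDeriv j v x)
        + ‖x‖ ^ 2 * partialDeriv j v x ^ 2
        + ‖x‖ ^ 2 * (∑ l, x l * partialDeriv j v x * partialDeriv j (partialDeriv l v) x)
        - gradSq v x * x j ^ 2 - 1 / 2 * ‖x‖ ^ 2 * gradSq v x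
        - ‖x‖ ^ 2 * (∑ l, x j * partialDeriv l v x * partialDeriv j (partialDeriv l v) x) := by
    intro j
    rw [partialDeriv_sub (d ((hN.mul (h1 j)).mul hE) x)
        (d ((hX j).mul (contDiff_const.mul (hN.mul hG))) x),
      partialDeriv_mul (d (hN.mul (h1 j)) x) (d hE x),
      partialDeriv_mul (d hN x) (d (h1 j) x),
      partialDeriv_mul (d (hX j) x) (d (contDiff_const.mul (hN.mul hG)) x),
      partialDeriv_const_mul (d (hN.mul hG) x), partialDeriv_mul (d hN x) (d hG x),
      eE, eG, partialDeriv_norm_sq, partialDeriv_coord]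
    simp only [if_true]
    have a1 : ∑ l, x l * partialDeriv j v x * partialDeriv j (partialDeriv l v) x
        = partialDeriv j v x * ∑ l, x l * partialDeriv j (partialDeriv l v) x := by
      rw [Finset.mul_sum]
      exact Finset.sum_congr rfl fun l _ => by ring
    have a2 : ∑ l, 2 * partialDeriv l v x * partialDeriv j (partialDeriv l v) x
        = 2 * ∑ l, partialDeriv l v x * partialDeriv j (partialDeriv l v) x := by
      rw [Finset.mul_sum]
      exact Finset.sum_congr rfl fun l _ => by ring
    have a3 : ∑ l, x j * partialDeriv l v x * partialDeriv j (partialDeriv l v) x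
        = x j * ∑ l, partialDeriv l v x * partialDeriv j (partialDeriv l v) x := by
      rw [Finset.mul_sum]
      exact Finset.sum_congr rfl fun l _ => by ring
    rw [a1, a2, a3]
    ring
  have swap : ∑ j, ∑ l, x l * partialDeriv j v x * partialDeriv j (partialDeriv l v) x
      = ∑ j, ∑ l, x j * partialDeriv l v x * partialDeriv j (partialDeriv l v) x := by
    rw [Finset.sum_comm]
    refine Finset.sum_congr rfl fun j _ => Finset.sum_congr rfl fun l _ => ?_
    rw [partialDeriv_comm hv]
  simp only [e, Finset.sum_sub_distrib, Finset.sum_add_distrib, ← Finset.mul_sum, swap,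
    ← norm_sq_eq_sum]
  have eE' : ∑ j, x j * partialDeriv j v x = euler v x := rfl
  have eG' : ∑ j, partialDeriv j v x ^ 2 = gradSq v x := rfl
  have eL' : ∑ j, partialDeriv j (partialDeriv j v) x = lap v x := rfl
  simp only [eE', eG', eL']
  simp
  ring

end Identities

/-! ### The Carleman estimate for smooth functions by the multiplier method. -/

section CarlemanSmooth

variable {n : ℕ} {v : RSpace n → ℝ}

/-- The operator `|x|² e^φ (Δ + k² q) e^{-φ}` with `φ = τ log |x|`. -/
noncomputable def conjugatedOperator (τ k : ℝ) (q v : RSpace n → ℝ) (x : RSpace n) : ℝ :=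
  ‖x‖ ^ 2 * lap v x - 2 * τ * euler v x + (τ * (τ + 2 - n) + k ^ 2 * (‖x‖ ^ 2 * q x)) * v x

theorem continuous_conjugatedOperator {τ k : ℝ} {q : RSpace n → ℝ} (hq : Continuous q)
    (hv : ContDiff ℝ ∞ v) : Continuous (conjugatedOperator τ k q v) := by
  unfold conjugatedOperator
  have := (contDiff_lap hv).continuous
  have := (contDiff_euler hv).continuous
  have := hv.continuous
  fun_prop

theorem HasCompactSupport.conjugatedOperator {τ k : ℝ} {q : RSpace n → ℝ}
    (hc : HasCompactSupport v) : HasCompactSupport (conjugatedOperator τ k q v) :=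
  (hc.lap.mul_left.sub hc.euler.mul_left).add hc.mul_left

theorem integral_sq_nonneg (f : RSpace n → ℝ) : 0 ≤ ∫ x, f x ^ 2 :=
  integral_nonneg fun x => sq_nonneg (f x)

theorem integrable_mul_of_hasCompactSupport {f g : RSpace n → ℝ} (hf : Continuous f)
    (hg : Continuous g) (hc : HasCompactSupport g) : Integrable (fun x => f x * g x) :=
  (hf.mul hg).integrable_of_hasCompactSupport hc.mul_left

theorem integrable_sq_of_hasCompactSupport {f : RSpace n → ℝ} (hf : Continuous f)
    (hc : HasCompactSupport f) : Integrable (fun x => f x ^ 2) := by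
  simpa only [pow_two] using integrable_mul_of_hasCompactSupport hf hf hc

/-- The shift `n/2` in the multiplier makes the gradient terms cancel, and the constant part of the
potential drops out because it pairs `v` with its image under a skew operator. Only a square and the
radial derivative of `|x|²q` survive. -/
theorem integral_conjugatedOperator_mul_skewEuler {τ k : ℝ} {q : RSpace n → ℝ}
    (hq : ContDiff ℝ 1 q) (hv : ContDiff ℝ ∞ v) (hc : HasCompactSupport v) :
    ∫ x, (conjugatedOperator τ k q v x * skewEuler v x + (2 * τ + 2) * skewEuler v x ^ 2
      + k ^ 2 * (1 / 2 * euler (fun y => ‖y‖ ^ 2 * q y) x * v x ^ 2)) = 0 := by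
  have hN : ContDiff ℝ 1 (fun x : RSpace n => ‖x‖ ^ 2) := contDiff_norm_sq ℝ
  have hV : ContDiff ℝ 1 (fun x : RSpace n => ‖x‖ ^ 2 * q x) := hN.mul hq
  have A := integral_norm_sq_lap_mul_euler hv hc
  have B := integral_norm_sq_lap_mul_self hv hc
  have C := integral_weight_mul_skewEuler (V := fun _ => (1 : ℝ)) contDiff_const hv hc
  have D := integral_weight_mul_skewEuler hV hv hc
  have cN := hN.continuous
  have cL := (contDiff_lap hv).continuous
  have cE := (contDiff_euler hv).continuous
  have cG := (contDiff_gradSq hv).continuous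
  have cS := (contDiff_skewEuler hv).continuous
  have cv := hv.continuous
  have cq := hq.continuous
  have cEV : Continuous (euler (fun x : RSpace n => ‖x‖ ^ 2 * q x)) :=
    continuous_finsetSum _ fun j _ =>
      (contDiff_coord j (m := 1)).continuous.mul (continuous_partialDeriv hV j)
  have e1 : ∀ x : RSpace n, euler (fun _ => (1 : ℝ)) x = 0 := by
    intro x
    simp [euler, partialDeriv]
  simp only [e1] at C
  have v2 : HasCompactSupport (fun x => v x ^ 2) := by
    simp only [pow_two]
    exact hc.mul_left
  have iA : Integrable fun x => ‖x‖ ^ 2 * lap v x * euler v x + 2 * euler v x ^ 2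
      - n / 2 * (‖x‖ ^ 2 * gradSq v x) := by
    refine Continuous.integrable_of_hasCompactSupport (by fun_prop) ?_
    refine (hc.euler.mul_left.add ?_).sub hc.gradSq.mul_left.mul_left
    simp only [pow_two]
    exact hc.euler.mul_left.mul_left
  have iB : Integrable fun x => ‖x‖ ^ 2 * lap v x * v x + ‖x‖ ^ 2 * gradSq v x
      - n * v x ^ 2 := by
    refine Continuous.integrable_of_hasCompactSupport (by fun_prop) ?_
    exact (hc.mul_left.add hc.gradSq.mul_left).sub v2.mul_left
  have iC : Integrable fun x => 1 * v x * skewEuler v x + 1 / 2 * 0 * v x ^ 2 := by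
    refine Continuous.integrable_of_hasCompactSupport (by fun_prop) ?_
    exact hc.skewEuler.mul_left.add v2.mul_left
  have iD : Integrable fun x => ‖x‖ ^ 2 * q x * v x * skewEuler v x
      + 1 / 2 * euler (fun y => ‖y‖ ^ 2 * q y) x * v x ^ 2 := by
    refine Continuous.integrable_of_hasCompactSupport (by fun_prop) ?_
    exact hc.skewEuler.mul_left.add v2.mul_left
  -- The weight `n/2` completes `x·∇v` to `skewEuler v` against the Laplacian. Replacing `euler` by
  -- `skewEuler − n/2` produces multiples of `∫ v Sv = 0`: `2n` from `−2(x·∇v)²`, `nτ` from the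
  -- drift, and `τ(τ+2−n)` from the potential.
  have key := integral_add (iA.add (iB.const_mul (n / 2 : ℝ)))
    ((iC.const_mul (2 * n + n * τ + τ * (τ + 2 - n) : ℝ)).add (iD.const_mul (k ^ 2)))
  simp only [Pi.add_apply] at key
  rw [integral_add iA (iB.const_mul (n / 2 : ℝ)), integral_add (iC.const_mul _)
    (iD.const_mul (k ^ 2)), integral_const_mul, integral_const_mul, integral_const_mul, A, B, C,
    D] at key
  simp only [mul_zero, add_zero] at key
  rw [← key]
  congr 1
  funext x
  simp only [conjugatedOperator, skewEuler]
  ring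

theorem euler_norm_sq_mul {q : RSpace n → ℝ} (hq : ContDiff ℝ 1 q) (x : RSpace n) :
    euler (fun y => ‖y‖ ^ 2 * q y) x = 2 * (‖x‖ ^ 2 * q x) + ‖x‖ ^ 2 * euler q x := by
  have hN : ContDiff ℝ 1 (fun x : RSpace n => ‖x‖ ^ 2) := contDiff_norm_sq ℝ
  have e : ∀ j, x j * partialDeriv j (fun y => ‖y‖ ^ 2 * q y) x
      = 2 * q x * x j ^ 2 + ‖x‖ ^ 2 * (x j * partialDeriv j q x) := by
    intro j
    rw [partialDeriv_mul (hN.differentiable (by simp) x) (hq.differentiable (by simp) x),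
      partialDeriv_norm_sq]
    ring
  simp only [euler, e, Finset.sum_add_distrib, ← Finset.mul_sum, ← norm_sq_eq_sum]
  ring

/-- A Hardy-type inequality: the weight `V = 2|x|²` has `x·∇V = 4|x|² > 0`. Since `1/4 ≤ |x|² ≤ 16`
on the support, the cross term is absorbed with constant 1024 while `v²/4` remains. -/
theorem integral_sq_le_integral_skewEuler_sq (hv : ContDiff ℝ ∞ v) (hc : HasCompactSupport v)
    (hs : ∀ x, v x ≠ 0 → 1 / 2 ≤ ‖x‖ ∧ ‖x‖ ≤ 4) :
    ∫ x, v x ^ 2 ≤ 4096 * ∫ x, skewEuler v x ^ 2 := by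
  have hN : ContDiff ℝ 1 (fun x : RSpace n => ‖x‖ ^ 2 * 2) :=
    (contDiff_norm_sq ℝ).mul contDiff_const
  have key := integral_weight_mul_skewEuler hN hv hc
  have cS := (contDiff_skewEuler hv).continuous
  have cv := hv.continuous
  have iv := integrable_sq_of_hasCompactSupport cv hc
  have iS := integrable_sq_of_hasCompactSupport cS hc.skewEuler
  have e1 : ∀ x : RSpace n, euler (fun y => ‖y‖ ^ 2 * 2) x = 4 * ‖x‖ ^ 2 := by
    intro x
    rw [euler_norm_sq_mul (q := fun _ => 2) contDiff_const]
    simp [euler, partialDeriv]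
    ring
  simp only [e1] at key
  have v2 : HasCompactSupport (fun x => v x ^ 2) := by
    simp only [pow_two]
    exact hc.mul_left
  have iK : Integrable fun x => ‖x‖ ^ 2 * 2 * v x * skewEuler v x
      + 1 / 2 * (4 * ‖x‖ ^ 2) * v x ^ 2 := by
    refine Continuous.integrable_of_hasCompactSupport (by fun_prop) ?_
    exact hc.skewEuler.mul_left.add v2.mul_left
  have hle : ∫ x, (1 / 4 * v x ^ 2 - 1024 * skewEuler v x ^ 2)
      ≤ ∫ x, (‖x‖ ^ 2 * 2 * v x * skewEuler v x + 1 / 2 * (4 * ‖x‖ ^ 2) * v x ^ 2) := by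
    refine integral_mono ((iv.const_mul _).sub (iS.const_mul _)) iK fun x => ?_
    show 1 / 4 * v x ^ 2 - 1024 * skewEuler v x ^ 2
      ≤ ‖x‖ ^ 2 * 2 * v x * skewEuler v x + 1 / 2 * (4 * ‖x‖ ^ 2) * v x ^ 2
    by_cases h : v x = 0
    · rw [h]
      nlinarith [sq_nonneg (skewEuler v x)]
    · obtain ⟨h1, h2⟩ := hs x h
      have h3 : 1 / 4 ≤ ‖x‖ ^ 2 := by nlinarith
      have h4 : ‖x‖ ^ 2 ≤ 16 := by nlinarith
      set r := ‖x‖ ^ 2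
      set s := skewEuler v x
      have h5 : -(r * 2 * v x * s) ≤ 1 / 4 * v x ^ 2 + 1024 * s ^ 2 := by
        have : 0 ≤ (1 / 2 * v x + 2 * r * s) ^ 2 := sq_nonneg _
        have : r ^ 2 * s ^ 2 ≤ 256 * s ^ 2 :=
          mul_le_mul_of_nonneg_right (by nlinarith) (sq_nonneg s)
        nlinarith
      have h6 : 1 / 4 * v x ^ 2 ≤ r * v x ^ 2 := mul_le_mul_of_nonneg_right h3 (sq_nonneg _)
      linarith
  rw [key, integral_sub (iv.const_mul _) (iS.const_mul _), integral_const_mul,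
    integral_const_mul] at hle
  linarith

/-- The Carleman estimate for smooth functions supported away from the origin. -/
theorem carleman_smooth {τ k : ℝ} (hτ : 1 ≤ τ) {q : RSpace n → ℝ} (hq : ContDiff ℝ 1 q)
    (hq0 : ∀ x, 0 ≤ q x) (hq1 : ∀ x, 0 ≤ euler q x)
    (hv : ContDiff ℝ ∞ v) (hc : HasCompactSupport v)
    (hs : ∀ x, v x ≠ 0 → 1 / 2 ≤ ‖x‖ ∧ ‖x‖ ≤ 4) :
    τ ^ 2 * (∫ x, v x ^ 2) + (∫ x, ‖x‖ ^ 2 * gradSq v x)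
        + τ * k ^ 2 * (∫ x, ‖x‖ ^ 2 * q x * v x ^ 2)
      ≤ 1024 * (n + 5) * ∫ x, conjugatedOperator τ k q v x ^ 2 := by
  have cS := (contDiff_skewEuler hv).continuous
  have cE := (contDiff_euler hv).continuous
  have cG := (contDiff_gradSq hv).continuous
  have cL := (contDiff_lap hv).continuous
  have cv := hv.continuous
  have cq := hq.continuous
  have cP : Continuous (conjugatedOperator τ k q v) := continuous_conjugatedOperator cq hv
  have hV : ContDiff ℝ 1 (fun x : RSpace n => ‖x‖ ^ 2 * q x) := (contDiff_norm_sq ℝ).mul hq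
  have cEV : Continuous (euler (fun x : RSpace n => ‖x‖ ^ 2 * q x)) :=
    continuous_finsetSum _ fun j _ =>
      (contDiff_coord j (m := 1)).continuous.mul (continuous_partialDeriv hV j)
  have hP : HasCompactSupport (conjugatedOperator τ k q v) := hc.conjugatedOperator
  have v2 : HasCompactSupport (fun x => v x ^ 2) := by
    simp only [pow_two]
    exact hc.mul_left
  have S2 : HasCompactSupport (fun x => skewEuler v x ^ 2) := by
    simp only [pow_two]
    exact hc.skewEuler.mul_left
  have iv := integrable_sq_of_hasCompactSupport cv hc
  have iS := integrable_sq_of_hasCompactSupport cS hc.skewEuler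
  have iP := integrable_sq_of_hasCompactSupport cP hP
  have iQ : Integrable (fun x => ‖x‖ ^ 2 * q x * v x ^ 2) :=
    Continuous.integrable_of_hasCompactSupport (by fun_prop) v2.mul_left
  have iG : Integrable (fun x => ‖x‖ ^ 2 * gradSq v x) :=
    Continuous.integrable_of_hasCompactSupport (by fun_prop) hc.gradSq.mul_left
  have hW := integral_sq_le_integral_skewEuler_sq hv hc hs
  set A := ∫ x, conjugatedOperator τ k q v x ^ 2 with hA
  set T := ∫ x, skewEuler v x ^ 2 with hT
  set W := ∫ x, v x ^ 2 with hWd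
  set Q := ∫ x, ‖x‖ ^ 2 * q x * v x ^ 2 with hQ
  set Γ := ∫ x, ‖x‖ ^ 2 * gradSq v x with hΓ
  have hA0 : 0 ≤ A := integral_sq_nonneg _
  have hT0 : 0 ≤ T := integral_sq_nonneg _
  have hW0 : 0 ≤ W := integral_sq_nonneg _
  have hQ0 : 0 ≤ Q := integral_nonneg fun x => by
    have := hq0 x
    positivity
  have hn : (0 : ℝ) ≤ n := Nat.cast_nonneg n
  -- the multiplier `x · ∇ v + n / 2 v`
  have m1 : 4 * (τ + 1) ^ 2 * T + 4 * (τ + 1) * (k ^ 2 * Q) ≤ A := by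
    have I := integral_conjugatedOperator_mul_skewEuler (τ := τ) (k := k) hq hv hc
    -- Half of `(2τ+2)s²` absorbs the product: `ps ≥ −p²/(4(τ+1)) − (τ+1)s²`. Radial monotonicity
    -- allows the term with `x·∇q` to be dropped.
    have hle : ∫ x, (((τ + 1) * skewEuler v x ^ 2 + k ^ 2 * (‖x‖ ^ 2 * q x * v x ^ 2))
          - 1 / (4 * (τ + 1)) * conjugatedOperator τ k q v x ^ 2)
        ≤ ∫ x, (conjugatedOperator τ k q v x * skewEuler v x + (2 * τ + 2) * skewEuler v x ^ 2
          + k ^ 2 * (1 / 2 * euler (fun y => ‖y‖ ^ 2 * q y) x * v x ^ 2)) := by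
      refine integral_mono (((iS.const_mul _).add (iQ.const_mul _)).sub (iP.const_mul _)) ?_
        fun x => ?_
      · refine Continuous.integrable_of_hasCompactSupport (by fun_prop) ?_
        exact (hc.skewEuler.mul_left.add S2.mul_left).add v2.mul_left.mul_left
      · simp only [euler_norm_sq_mul hq]
        set p := conjugatedOperator τ k q v x
        set s := skewEuler v x
        have h1 : 0 ≤ k ^ 2 * (‖x‖ ^ 2 * euler q x * v x ^ 2) := by
          have := hq1 x
          positivity
        have h2 : 0 ≤ 1 / (4 * (τ + 1)) * (p + 2 * (τ + 1) * s) ^ 2 := by positivity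
        have h3 : 1 / (4 * (τ + 1)) * (p + 2 * (τ + 1) * s) ^ 2
            = 1 / (4 * (τ + 1)) * p ^ 2 + p * s + (τ + 1) * s ^ 2 := by
          field_simp
          ring
        rw [h3] at h2
        nlinarith
    rw [I, integral_sub ((iS.const_mul _).fun_add (iQ.const_mul _)) (iP.const_mul _),
      integral_add (iS.const_mul _) (iQ.const_mul _), integral_const_mul,
      integral_const_mul, integral_const_mul, ← hT, ← hQ, ← hA] at hle
    have h4 : 4 * (τ + 1) * ((τ + 1) * T + k ^ 2 * Q - 1 / (4 * (τ + 1)) * A) ≤ 0 :=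
      mul_nonpos_of_nonneg_of_nonpos (by positivity) hle
    have h5 : 4 * (τ + 1) * ((τ + 1) * T + k ^ 2 * Q - 1 / (4 * (τ + 1)) * A)
        = 4 * (τ + 1) ^ 2 * T + 4 * (τ + 1) * k ^ 2 * Q - A := by
      field_simp
    rw [h5] at h4
    linarith
  -- the multiplier `v`
  have m2 : Γ ≤ 1 / 2 * A + 1 / 2 * W + (τ ^ 2 + 2 * τ + n) * W + k ^ 2 * Q := by
    have I := integral_norm_sq_lap_mul_self hv hc
    have J := integral_weight_mul_skewEuler (V := fun _ => (1 : ℝ)) contDiff_const hv hc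
    have e1 : ∀ x : RSpace n, euler (fun _ => (1 : ℝ)) x = 0 := by
      intro x
      simp [euler, partialDeriv]
    simp only [e1] at J
    have iI : Integrable fun x => ‖x‖ ^ 2 * lap v x * v x + ‖x‖ ^ 2 * gradSq v x
        - n * v x ^ 2 := by
      refine Continuous.integrable_of_hasCompactSupport (by fun_prop) ?_
      exact (hc.mul_left.add hc.gradSq.mul_left).sub v2.mul_left
    have iJ : Integrable fun x => 1 * v x * skewEuler v x + 1 / 2 * 0 * v x ^ 2 := by
      refine Continuous.integrable_of_hasCompactSupport (by fun_prop) ?_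
      exact hc.skewEuler.mul_left.add v2.mul_left
    -- Here `∫ |x|²|∇v|²` is rewritten through `−∫ Pv·v`; the multiple `−2τ` of `∫ v Sv = 0` removes
    -- the drift, and Young's inequality handles `Pv·v`.
    have hle : ∫ x, ‖x‖ ^ 2 * gradSq v x
        ≤ ∫ x, (((1 / 2 * conjugatedOperator τ k q v x ^ 2 + 1 / 2 * v x ^ 2)
          + ((τ ^ 2 + 2 * τ + n) * v x ^ 2 + k ^ 2 * (‖x‖ ^ 2 * q x * v x ^ 2)))
          + ((‖x‖ ^ 2 * lap v x * v x + ‖x‖ ^ 2 * gradSq v x - n * v x ^ 2)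
            + (-2 * τ) * (1 * v x * skewEuler v x + 1 / 2 * 0 * v x ^ 2))) := by
      refine integral_mono iG ((((iP.const_mul _).add (iv.const_mul _)).add
        ((iv.const_mul _).add (iQ.const_mul _))).add (iI.add (iJ.const_mul _))) fun x => ?_
      show ‖x‖ ^ 2 * gradSq v x
        ≤ ((1 / 2 * conjugatedOperator τ k q v x ^ 2 + 1 / 2 * v x ^ 2)
          + ((τ ^ 2 + 2 * τ + n) * v x ^ 2 + k ^ 2 * (‖x‖ ^ 2 * q x * v x ^ 2)))
          + ((‖x‖ ^ 2 * lap v x * v x + ‖x‖ ^ 2 * gradSq v x - n * v x ^ 2)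
            + (-2 * τ) * (1 * v x * skewEuler v x + 1 / 2 * 0 * v x ^ 2))
      have h1 : 0 ≤ (conjugatedOperator τ k q v x + v x) ^ 2 := sq_nonneg _
      have h2 : conjugatedOperator τ k q v x * v x
          = ‖x‖ ^ 2 * lap v x * v x - 2 * τ * euler v x * v x
            + (τ * (τ + 2 - n) + k ^ 2 * (‖x‖ ^ 2 * q x)) * v x ^ 2 := by
        simp only [conjugatedOperator]
        ring
      simp only [skewEuler]
      nlinarith
    rw [integral_add (((iP.const_mul _).fun_add (iv.const_mul _)).fun_add
        ((iv.const_mul _).fun_add (iQ.const_mul _))) (iI.fun_add (iJ.const_mul _)),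
      integral_add ((iP.const_mul _).fun_add (iv.const_mul _))
        ((iv.const_mul _).fun_add (iQ.const_mul _)),
      integral_add (iP.const_mul _) (iv.const_mul _), integral_add (iv.const_mul _)
        (iQ.const_mul _), integral_add iI (iJ.const_mul _), integral_const_mul,
      integral_const_mul, integral_const_mul, integral_const_mul, integral_const_mul, I, J] at hle
    linarith
  have hQk : 0 ≤ k ^ 2 * Q := by positivity
  have b1 : 4 * ((τ + 1) ^ 2 * T) ≤ A := by nlinarith
  have b2 : 4 * ((τ + 1) * (k ^ 2 * Q)) ≤ A := by
    nlinarith [mul_nonneg (sq_nonneg (τ + 1)) hT0]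
  have b3 : (τ + 1) ^ 2 * W ≤ 1024 * A := by
    nlinarith [mul_le_mul_of_nonneg_left hW (sq_nonneg (τ + 1))]
  have b4 : (τ ^ 2 + (1 / 2 + τ ^ 2 + 2 * τ + n)) * W ≤ (n + 2) * ((τ + 1) ^ 2 * W) := by
    rw [← mul_assoc]
    refine mul_le_mul_of_nonneg_right ?_ hW0
    nlinarith
  have b5 : (n + 2) * ((τ + 1) ^ 2 * W) ≤ (n + 2) * (1024 * A) :=
    mul_le_mul_of_nonneg_left b3 (by positivity)
  nlinarith [mul_nonneg hn hA0]

end CarlemanSmooth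

/-! ### Solving `(Δ − M²)w = div H` by Fourier multipliers. -/

section Resolvent

open SchwartzMap LineDeriv Laplacian FourierTransform
open scoped SchwartzMap

variable {n : ℕ}

/-- The symbol is `M⁻²` times a dilate of the Bessel symbol `(1 + |ξ|²)⁻¹`. -/
theorem hasTemperateGrowth_resolvent_symbol {M : ℝ} (hM : 0 < M) :
    (fun ξ : RSpace n => ((2 * Real.pi) ^ 2 * ‖ξ‖ ^ 2 + M ^ 2)⁻¹).HasTemperateGrowth := by
  have h := Function.hasTemperateGrowth_one_add_norm_sq_rpow (RSpace n) (-1)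
  have h2 := h.comp ((2 * Real.pi / M) • ContinuousLinearMap.id ℝ (RSpace n)).hasTemperateGrowth
  have h3 := (Function.HasTemperateGrowth.const (M ^ 2)⁻¹).mul h2
  have e : (fun ξ : RSpace n => ((2 * Real.pi) ^ 2 * ‖ξ‖ ^ 2 + M ^ 2)⁻¹)
      = (fun _ => (M ^ 2)⁻¹) * ((fun x : RSpace n => (1 + ‖x‖ ^ 2) ^ (-1 : ℝ))
        ∘ ((2 * Real.pi / M) • ContinuousLinearMap.id ℝ (RSpace n))) := by
    funext ξ
    simp only [Function.comp, Pi.mul_apply, smul_apply,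
      ContinuousLinearMap.id_apply, norm_smul, Real.norm_eq_abs, Real.rpow_neg_one]
    rw [mul_pow |2 * Real.pi / M|, sq_abs, ← mul_inv]
    congr 1
    field_simp
    ring
  rw [e]
  exact h3

/-- On the Fourier side `Δ − M²` is multiplication by `−((2π)²|ξ|² + M²)`, which never vanishes; the
minus sign explains why the multiplier acts on `−g`. -/
theorem exists_schwartz_resolvent {M : ℝ} (hM : 0 < M) (g : 𝓢(RSpace n, ℂ)) :
    ∃ w : 𝓢(RSpace n, ℂ), Δ w - (M ^ 2 : ℝ) • w = g := by
  let m : RSpace n → ℝ := fun ξ => ((2 * Real.pi) ^ 2 * ‖ξ‖ ^ 2 + M ^ 2)⁻¹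
  let N : RSpace n → ℝ := fun ξ => ‖ξ‖ ^ 2
  have hm : m.HasTemperateGrowth := hasTemperateGrowth_resolvent_symbol hM
  have hN : N.HasTemperateGrowth := by fun_prop
  refine ⟨fourierMultiplierCLM ℂ m (-g), ?_⟩
  have h1 : fourierMultiplierCLM ℂ N (fourierMultiplierCLM ℂ m (-g))
      = fourierMultiplierCLM ℂ (N * m) (-g) :=
    fourierMultiplierCLM_fourierMultiplierCLM_apply hN hm (-g)
  have hNm : (N * m).HasTemperateGrowth := hN.mul hm
  have h2 : -(2 * Real.pi) ^ 2 • smulLeftCLM ℂ (N * m) (𝓕 (-g))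
      - (M ^ 2 : ℝ) • smulLeftCLM ℂ m (𝓕 (-g)) = 𝓕 g := by
    rw [FourierTransform.fourier_neg]
    ext ξ
    simp only [sub_apply, smul_apply, neg_apply,
      smulLeftCLM_apply_apply hNm, smulLeftCLM_apply_apply hm, smul_neg, smul_smul, ← neg_smul, ← sub_smul]
    have : -(2 * Real.pi) ^ 2 * -(N * m) ξ - M ^ 2 * -m ξ = 1 := by
      have : (2 * Real.pi) ^ 2 * ‖ξ‖ ^ 2 + M ^ 2 ≠ 0 := by positivity
      simp only [Pi.mul_apply, N, m]
      field_simp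
      ring
    rw [this, one_smul]
  have h3 : Δ (fourierMultiplierCLM ℂ m (-g)) = -(2 * Real.pi) ^ 2 •
      fourierMultiplierCLM ℂ N (fourierMultiplierCLM ℂ m (-g)) :=
    laplacian_eq_fourierMultiplierCLM _
  rw [h3, h1, fourierMultiplierCLM_apply, fourierMultiplierCLM_apply,
    ← FourierTransform.fourierInv_smul, ← FourierTransform.fourierInv_smul,
    sub_eq_add_neg, ← FourierTransform.fourierInv_neg, ← FourierTransform.fourierInv_add,
    ← sub_eq_add_neg, h2, FourierTransform.fourierInv_fourier_eq]

theorem schwartz_laplacian_apply (w : 𝓢(RSpace n, ℝ)) (x : RSpace n) : Δ w x = lap w x := by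
  rw [SchwartzMap.laplacian_eq_sum (EuclideanSpace.basisFun (Fin n) ℝ), sum_apply]
  refine Finset.sum_congr rfl fun j _ => ?_
  rw [EuclideanSpace.basisFun_apply]
  rfl

/-- Taking real parts commutes with derivatives, and `M²` is real, so the real part of the complex
solution solves the real equation. -/
theorem exists_real_schwartz_resolvent {M : ℝ} (hM : 0 < M) (g : 𝓢(RSpace n, ℝ)) :
    ∃ w : 𝓢(RSpace n, ℝ), ∀ x, lap w x - M ^ 2 * w x = g x := by
  obtain ⟨w, hw⟩ := exists_schwartz_resolvent hM (g.postcompCLM Complex.ofRealCLM)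
  refine ⟨w.postcompCLM Complex.reCLM, fun x => ?_⟩
  have hd : ∀ (f : 𝓢(RSpace n, ℂ)) (m : RSpace n),
      ∂_{m} (f.postcompCLM Complex.reCLM) = (∂_{m} f).postcompCLM Complex.reCLM := by
    intro f m
    ext y
    have := (Complex.reCLM.hasFDerivAt.comp y (f.hasFDerivAt y)).fderiv
    rw [SchwartzMap.lineDerivOp_apply_eq_fderiv, SchwartzMap.postcompCLM_apply,
      SchwartzMap.lineDerivOp_apply_eq_fderiv]
    have e : ⇑(f.postcompCLM Complex.reCLM) = Complex.reCLM ∘ f := rfl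
    rw [e, this]
    rfl
  have hl : Δ (w.postcompCLM Complex.reCLM) = (Δ w).postcompCLM Complex.reCLM := by
    rw [SchwartzMap.laplacian_eq_sum (EuclideanSpace.basisFun (Fin n) ℝ),
      SchwartzMap.laplacian_eq_sum (EuclideanSpace.basisFun (Fin n) ℝ), map_sum]
    simp only [hd]
  rw [← schwartz_laplacian_apply, hl]
  have hM2 : (M : ℂ) ^ 2 = ((M ^ 2 : ℝ) : ℂ) := by push_cast; rfl
  have hre : ((M : ℂ) ^ 2).re = M ^ 2 := by rw [hM2, Complex.ofReal_re]
  have him : ((M : ℂ) ^ 2).im = 0 := by rw [hM2, Complex.ofReal_im]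
  have := congrArg (fun f : 𝓢(RSpace n, ℂ) => (f x).re) hw
  simpa [hre, him] using this

/-- Solvability of `(Δ - M²) w = div H` with the energy estimate. -/
theorem exists_resolvent_divergence {M : ℝ} (hM : 0 < M) {H : Fin n → RSpace n → ℝ}
    (hH : ∀ j, ContDiff ℝ ∞ (H j)) (hc : ∀ j, HasCompactSupport (H j)) :
    ∃ w : RSpace n → ℝ, ContDiff ℝ ∞ w
      ∧ (∀ x, lap w x = M ^ 2 * w x + ∑ j, partialDeriv j (H j) x)
      ∧ Integrable (fun x => w x ^ 2) ∧ Integrable (fun x => gradSq w x)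
      ∧ M ^ 2 * (∫ x, w x ^ 2) + (∫ x, gradSq w x) ≤ ∑ j, ∫ x, H j x ^ 2 := by
  let h : Fin n → 𝓢(RSpace n, ℝ) := fun j => (hc j).toSchwartzMap (hH j)
  let e : Fin n → RSpace n := fun j => EuclideanSpace.single j 1
  obtain ⟨w, hw⟩ := exists_real_schwartz_resolvent hM (∑ j, ∂_{e j} (h j))
  have hw' : ∀ x, lap w x = M ^ 2 * w x + ∑ j, partialDeriv j (H j) x := by
    intro x
    have := hw x
    rw [sum_apply] at this
    have e2 : ∑ j, (∂_{e j} (h j)) x = ∑ j, partialDeriv j (H j) x := rfl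
    rw [e2] at this
    linarith
  have hmul : ∀ f g : 𝓢(RSpace n, ℝ), Integrable (fun x => f x * g x) := fun f g =>
    (SchwartzMap.pairing (ContinuousLinearMap.mul ℝ ℝ) f g).integrable
  have hsq : ∀ f : 𝓢(RSpace n, ℝ), Integrable (fun x => f x ^ 2) := fun f => by
    simpa only [pow_two] using hmul f f
  have iD : ∀ j, Integrable (fun x => partialDeriv j w x ^ 2) := fun j => hsq (∂_{e j} w)
  have iL : ∀ j, Integrable (fun x => w x * partialDeriv j (partialDeriv j w) x) :=
    fun j => hmul w (∂_{e j} (∂_{e j} w))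
  have iH : ∀ j, Integrable (fun x => H j x ^ 2) := fun j => hsq (h j)
  have hG : Integrable (fun x => gradSq w x) :=
    integrable_finsetSum _ fun j _ => hsq (∂_{e j} w)
  refine ⟨w, w.smooth ⊤, hw', hsq w, hG, ?_⟩
  have ibp : ∀ (f : 𝓢(RSpace n, ℝ)) j, ∫ x, w x * (∂_{e j} f) x
      = -∫ x, partialDeriv j w x * f x := fun f j =>
    SchwartzMap.integral_mul_lineDerivOp_right_eq_neg_left w f (e j)
  have I1 : ∫ x, w x * lap w x = -∫ x, gradSq w x := by
    simp only [lap, gradSq, Finset.mul_sum]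
    rw [integral_finsetSum _ (fun j _ => iL j),
      integral_finsetSum _ (fun j _ => iD j), ← Finset.sum_neg_distrib]
    refine Finset.sum_congr rfl fun j _ => ?_
    rw [show (fun x => partialDeriv j w x ^ 2) = fun x => partialDeriv j w x * partialDeriv j w x
      from funext fun x => pow_two _]
    exact ibp (∂_{e j} w) j
  have I2 : ∫ x, w x * lap w x = M ^ 2 * (∫ x, w x ^ 2)
      - ∑ j, ∫ x, partialDeriv j w x * H j x := by
    have : ∀ x, w x * lap w x = M ^ 2 * w x ^ 2 + ∑ j, w x * (∂_{e j} (h j)) x := by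
      intro x
      rw [hw', mul_add, Finset.mul_sum]
      have : ∀ j, (∂_{e j} (h j)) x = partialDeriv j (H j) x := fun j => rfl
      simp only [this]
      ring
    simp only [this]
    rw [integral_add ((hsq w).const_mul _)
      (integrable_finsetSum _ fun j _ => hmul w (∂_{e j} (h j))), integral_const_mul,
      integral_finsetSum _ (fun j _ => hmul w (∂_{e j} (h j)))]
    simp only [ibp, Finset.sum_neg_distrib]
    rfl
  -- Pairing the equation with `w` gives `M²‖w‖² + ‖∇w‖² = ∫ ∇w·H`; half of the gradient term is
  -- absorbed on the left.
  have I3 : -∑ j, ∫ x, partialDeriv j w x * H j x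
      ≥ -(1 / 2 * (∫ x, gradSq w x) + 1 / 2 * ∑ j, ∫ x, H j x ^ 2) := by
    have e3 : ∫ x, gradSq w x = ∑ j, ∫ x, partialDeriv j w x ^ 2 := by
      simp only [gradSq]
      exact integral_finsetSum _ (fun j _ => iD j)
    rw [e3, Finset.mul_sum, Finset.mul_sum, ← Finset.sum_add_distrib]
    refine neg_le_neg (Finset.sum_le_sum fun j _ => ?_)
    rw [← integral_const_mul, ← integral_const_mul,
      ← integral_add ((iD j).const_mul _) ((iH j).const_mul _)]
    refine integral_mono (hmul (∂_{e j} w) (h j))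
      (((iD j).const_mul _).add ((iH j).const_mul _)) fun x => ?_
    show partialDeriv j w x * H j x ≤ 1 / 2 * partialDeriv j w x ^ 2 + 1 / 2 * H j x ^ 2
    nlinarith [sq_nonneg (partialDeriv j w x - H j x)]
  have hw0 : 0 ≤ M ^ 2 * ∫ x, w x ^ 2 := mul_nonneg (sq_nonneg _) (integral_sq_nonneg _)
  linarith

end Resolvent

/-! ### Annular cutoff and lower-order remainders. -/

section CutoffEstimates

/-- The collected coefficients are `L + 256 + 64` for `X` and `1024 + 64 = 1088` for `Y`; both are
at most `L + 1088`. -/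
theorem sq_five_terms_le {B L X Y a b c d e : ℝ} (hB : 0 ≤ B) (hL : 0 ≤ L) (hX : 0 ≤ X)
    (hY : 0 ≤ Y) (ha : a ^ 2 ≤ B * L * X) (hb : b ^ 2 ≤ B * 1024 * Y) (hc : c ^ 2 ≤ B * 256 * X)
    (hd : d ^ 2 ≤ B * 64 * Y) (he : e ^ 2 ≤ B * 64 * X) :
    (a + b + c - d - e) ^ 2 ≤ 5 * B * (L + 1088) * (X + Y) := by
  have h : (a + b + c - d - e) ^ 2 ≤ 5 * (a ^ 2 + b ^ 2 + c ^ 2 + d ^ 2 + e ^ 2) := by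
    linarith [sq_nonneg (a - b), sq_nonneg (a - c), sq_nonneg (a + d), sq_nonneg (a + e),
      sq_nonneg (b - c), sq_nonneg (b + d), sq_nonneg (b + e), sq_nonneg (c + d),
      sq_nonneg (c + e), sq_nonneg (d - e)]
  have h1 : 0 ≤ B * X := mul_nonneg hB hX
  have h2 : 0 ≤ B * Y := mul_nonneg hB hY
  have h3 : 0 ≤ B * L * Y := mul_nonneg (mul_nonneg hB hL) hY
  linarith

variable {n : ℕ}

theorem lap_mul {f g : RSpace n → ℝ} (hf : ContDiff ℝ ∞ f) (hg : ContDiff ℝ ∞ g)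
    (x : RSpace n) :
    lap (fun y => f y * g y) x
      = f x * lap g x + 2 * (∑ j, partialDeriv j f x * partialDeriv j g x) + lap f x * g x := by
  have d : ∀ {h : RSpace n → ℝ}, ContDiff ℝ ∞ h → ∀ x, DifferentiableAt ℝ h x :=
    fun hh x => hh.differentiable (by simp) x
  have e : ∀ j, partialDeriv j (partialDeriv j (fun y => f y * g y)) x
      = f x * partialDeriv j (partialDeriv j g) x + 2 * (partialDeriv j f x * partialDeriv j g x)
        + partialDeriv j (partialDeriv j f) x * g x := by
    intro j
    have : partialDeriv j (fun y => f y * g y)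
        = fun y => f y * partialDeriv j g y + partialDeriv j f y * g y :=
      funext fun y => partialDeriv_mul (d hf y) (d hg y) j
    have hf' := contDiff_partialDeriv hf j
    have hg' := contDiff_partialDeriv hg j
    rw [this, partialDeriv_add (d (hf.mul hg') x) (d (hf'.mul hg) x),
      partialDeriv_mul (d hf x) (d hg' x), partialDeriv_mul (d hf' x) (d hg x)]
    ring
  simp only [lap, e, Finset.sum_add_distrib, ← Finset.mul_sum, ← Finset.sum_mul]

theorem lap_sub {f g : RSpace n → ℝ} (hf : ContDiff ℝ ∞ f) (hg : ContDiff ℝ ∞ g)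
    (x : RSpace n) : lap (fun y => f y - g y) x = lap f x - lap g x := by
  have d : ∀ {h : RSpace n → ℝ}, ContDiff ℝ ∞ h → ∀ x, DifferentiableAt ℝ h x :=
    fun hh x => hh.differentiable (by simp) x
  have e : ∀ j, partialDeriv j (partialDeriv j (fun y => f y - g y)) x
      = partialDeriv j (partialDeriv j f) x - partialDeriv j (partialDeriv j g) x := by
    intro j
    have : partialDeriv j (fun y => f y - g y)
        = fun y => partialDeriv j f y - partialDeriv j g y :=
      funext fun y => partialDeriv_sub (d hf y) (d hg y) j
    rw [this, partialDeriv_sub (d (contDiff_partialDeriv hf j) x)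
      (d (contDiff_partialDeriv hg j) x)]
  simp only [lap, e, Finset.sum_sub_distrib]

theorem euler_mul {f g : RSpace n → ℝ} (hf : ContDiff ℝ ∞ f) (hg : ContDiff ℝ ∞ g)
    (x : RSpace n) :
    euler (fun y => f y * g y) x = f x * euler g x + euler f x * g x := by
  have e : ∀ j, x j * partialDeriv j (fun y => f y * g y) x
      = f x * (x j * partialDeriv j g x) + (x j * partialDeriv j f x) * g x := by
    intro j
    rw [partialDeriv_mul (hf.differentiable (by simp) x) (hg.differentiable (by simp) x)]
    ring
  simp only [euler, e, Finset.sum_add_distrib, ← Finset.mul_sum, ← Finset.sum_mul]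

theorem euler_sub {f g : RSpace n → ℝ} (hf : ContDiff ℝ ∞ f) (hg : ContDiff ℝ ∞ g)
    (x : RSpace n) : euler (fun y => f y - g y) x = euler f x - euler g x := by
  have e : ∀ j, x j * partialDeriv j (fun y => f y - g y) x
      = x j * partialDeriv j f x - x j * partialDeriv j g x := by
    intro j
    rw [partialDeriv_sub (hf.differentiable (by simp) x) (hg.differentiable (by simp) x)]
    ring
  simp only [euler, e, Finset.sum_sub_distrib]

theorem conjugatedOperator_sub {τ k : ℝ} {q f g : RSpace n → ℝ} (hf : ContDiff ℝ ∞ f)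
    (hg : ContDiff ℝ ∞ g) (x : RSpace n) :
    conjugatedOperator τ k q (fun y => f y - g y) x
      = conjugatedOperator τ k q f x - conjugatedOperator τ k q g x := by
  simp only [conjugatedOperator, lap_sub hf hg, euler_sub hf hg]
  ring

theorem gradSq_nonneg (f : RSpace n → ℝ) (x : RSpace n) : 0 ≤ gradSq f x :=
  Finset.sum_nonneg fun _ _ => sq_nonneg _

theorem gradSq_mul_le {f g : RSpace n → ℝ} (hf : ContDiff ℝ ∞ f) (hg : ContDiff ℝ ∞ g)
    (x : RSpace n) :
    gradSq (fun y => f y * g y) x ≤ 2 * f x ^ 2 * gradSq g x + 2 * gradSq f x * g x ^ 2 := by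
  simp only [gradSq]
  rw [Finset.mul_sum, Finset.mul_sum, Finset.sum_mul, ← Finset.sum_add_distrib]
  refine Finset.sum_le_sum fun j _ => ?_
  rw [partialDeriv_mul (hf.differentiable (by simp) x) (hg.differentiable (by simp) x)]
  nlinarith [sq_nonneg (f x * partialDeriv j g x - partialDeriv j f x * g x)]

theorem gradSq_le_of_sub {f g : RSpace n → ℝ} (hf : ContDiff ℝ ∞ f) (hg : ContDiff ℝ ∞ g)
    (x : RSpace n) :
    gradSq f x ≤ 2 * gradSq (fun y => f y - g y) x + 2 * gradSq g x := by
  simp only [gradSq]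
  rw [Finset.mul_sum, Finset.mul_sum, ← Finset.sum_add_distrib]
  refine Finset.sum_le_sum fun j _ => ?_
  rw [partialDeriv_sub (hf.differentiable (by simp) x) (hg.differentiable (by simp) x)]
  nlinarith [sq_nonneg (partialDeriv j f x - 2 * partialDeriv j g x)]

theorem sum_partialDeriv_mul_sq_le (f g : RSpace n → ℝ) (x : RSpace n) :
    (∑ j, partialDeriv j f x * partialDeriv j g x) ^ 2 ≤ gradSq f x * gradSq g x :=
  Finset.sum_mul_sq_le_sq_mul_sq _ _ _

theorem euler_sq_le (f : RSpace n → ℝ) (x : RSpace n) :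
    euler f x ^ 2 ≤ ‖x‖ ^ 2 * gradSq f x := by
  rw [norm_sq_eq_sum]
  exact Finset.sum_mul_sq_le_sq_mul_sq _ _ _

/-- `χ` is a smooth cutoff that equals `1` on `1 ≤ |x| ≤ 2` and vanishes off
`1 / 2 ≤ |x| ≤ 4`, with derivatives controlled by `B`. -/
structure IsAnnularCutoff (χ : RSpace n → ℝ) (B : ℝ) : Prop where
  contDiff : ContDiff ℝ ∞ χ
  eq_one : ∀ x, 1 ≤ ‖x‖ → ‖x‖ ≤ 2 → χ x = 1
  support : ∀ x, χ x ≠ 0 → 1 / 2 ≤ ‖x‖ ∧ ‖x‖ ≤ 4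
  nonneg : 0 ≤ B
  sq_le : ∀ x, χ x ^ 2 ≤ B
  gradSq_le : ∀ x, gradSq χ x ≤ B
  lap_sq_le : ∀ x, lap χ x ^ 2 ≤ B

theorem hasCompactSupport_of_norm_le {f : RSpace n → ℝ} {r : ℝ} (h : ∀ x, f x ≠ 0 → ‖x‖ ≤ r) :
    HasCompactSupport f := by
  refine HasCompactSupport.intro (isCompact_closedBall (0 : RSpace n) r) fun x hx => ?_
  by_contra h0
  exact hx (by simpa using h x h0)

theorem tsupport_subset_of_norm_le {f : RSpace n → ℝ} {r : ℝ} (h : ∀ x, f x ≠ 0 → ‖x‖ ≤ r) :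
    tsupport f ⊆ {x | ‖x‖ ≤ r} :=
  closure_minimal h (isClosed_le continuous_norm continuous_const)

theorem exists_isAnnularCutoff (n : ℕ) :
    ∃ (χ : RSpace n → ℝ) (B : ℝ), IsAnnularCutoff χ B := by
  let b₁ : ContDiffBump (0 : RSpace n) := ⟨2, 4, by norm_num, by norm_num⟩
  let b₂ : ContDiffBump (0 : RSpace n) := ⟨1 / 2, 1, by norm_num, by norm_num⟩
  let χ : RSpace n → ℝ := fun x => b₁ x - b₂ x
  have hχ : ContDiff ℝ ∞ χ := b₁.contDiff.sub b₂.contDiff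
  have h1 : ∀ x, 1 ≤ ‖x‖ → ‖x‖ ≤ 2 → χ x = 1 := by
    intro x hx hx'
    have e1 : b₁ x = 1 := b₁.one_of_mem_closedBall (by simpa using hx')
    have e2 : b₂ x = 0 := b₂.zero_of_le_dist (by simpa using hx)
    simp [χ, e1, e2]
  have hs : ∀ x, χ x ≠ 0 → 1 / 2 ≤ ‖x‖ ∧ ‖x‖ ≤ 4 := by
    intro x hx
    constructor
    · by_contra! h
      have e1 : b₁ x = 1 := b₁.one_of_mem_closedBall (by simp; linarith)
      have e2 : b₂ x = 1 := b₂.one_of_mem_closedBall (by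
        simp only [Metric.mem_closedBall, dist_zero_right]; exact h.le)
      simp [χ, e1, e2] at hx
    · by_contra! h
      have e1 : b₁ x = 0 := b₁.zero_of_le_dist (by simpa using h.le)
      have e2 : b₂ x = 0 := b₂.zero_of_le_dist (by
        simp only [dist_zero_right]; show (1 : ℝ) ≤ _; linarith)
      simp [χ, e1, e2] at hx
  have hc : HasCompactSupport χ := hasCompactSupport_of_norm_le fun x hx => (hs x hx).2
  obtain ⟨B₁, hB₁⟩ := hχ.continuous.bounded_above_of_compact_support hc
  obtain ⟨B₂, hB₂⟩ := (contDiff_gradSq hχ).continuous.bounded_above_of_compact_support hc.gradSq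
  obtain ⟨B₃, hB₃⟩ := (contDiff_lap hχ).continuous.bounded_above_of_compact_support hc.lap
  have hB₂0 : 0 ≤ B₂ := (norm_nonneg _).trans (hB₂ 0)
  refine ⟨χ, B₁ ^ 2 + B₂ + B₃ ^ 2, hχ, h1, hs, by positivity, fun x => ?_, fun x => ?_,
    fun x => ?_⟩
  · have := sq_le_sq.2 ((hB₁ x).trans (le_abs_self _))
    nlinarith [sq_nonneg B₃]
  · have := (Real.le_norm_self _).trans (hB₂ x)
    nlinarith [sq_nonneg B₃, sq_nonneg B₁]
  · have := sq_le_sq.2 ((hB₃ x).trans (le_abs_self _))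
    nlinarith [sq_nonneg B₁]

namespace IsAnnularCutoff

variable {χ : RSpace n → ℝ} {B : ℝ}

theorem hasCompactSupport (h : IsAnnularCutoff χ B) : HasCompactSupport χ :=
  hasCompactSupport_of_norm_le fun x hx => (h.support x hx).2

theorem notMem_tsupport (h : IsAnnularCutoff χ B) {x : RSpace n} (hx : 4 < ‖x‖) :
    x ∉ tsupport χ := fun hx' =>
  absurd (tsupport_subset_of_norm_le (fun y hy => (h.support y hy).2) hx') (not_le.2 hx)

theorem partialDeriv_eq_zero (h : IsAnnularCutoff χ B) {x : RSpace n} (hx : 4 < ‖x‖)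
    (j : Fin n) : partialDeriv j χ x = 0 :=
  partialDeriv_eq_zero_of_notMem_tsupport (h.notMem_tsupport hx) j

theorem lap_eq_zero (h : IsAnnularCutoff χ B) {x : RSpace n} (hx : 4 < ‖x‖) : lap χ x = 0 := by
  refine Finset.sum_eq_zero fun j _ => partialDeriv_eq_zero_of_notMem_tsupport (fun hx' => ?_) j
  exact h.notMem_tsupport hx (tsupport_fderiv_apply_subset ℝ _ hx')

/-- The part of `conjugatedOperator τ k q (χ w)` of lower order, if `Δ w = M² w` plus a divergence
supported where `χ = 1`. -/
theorem remainder_sq_le (h : IsAnnularCutoff χ B) {κ M τ k : ℝ} (hκ : 1 ≤ κ) (hτ : 1 ≤ τ)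
    (hk : 1 ≤ k) (hτM : τ ≤ M) (hkM : k ≤ M) {q : RSpace n → ℝ} (hq : ∀ x, 0 ≤ q x)
    (hqκ : ∀ x, q x ≤ κ) (w : RSpace n → ℝ) (x : RSpace n) :
    (‖x‖ ^ 2 * (χ x * (M ^ 2 * w x) + 2 * (∑ j, partialDeriv j χ x * partialDeriv j w x)
        + lap χ x * w x)
      - 2 * τ * (χ x * euler w x + euler χ x * w x)
      + (τ * (τ + 2 - n) + k ^ 2 * (‖x‖ ^ 2 * q x)) * (χ x * w x)) ^ 2
    ≤ 5 * B * ((19 + n + 16 * κ) ^ 2 + 1088) * (M ^ 4 * w x ^ 2 + M ^ 2 * gradSq w x) := by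
  have hB := h.nonneg
  have hM : 1 ≤ M := hτ.trans hτM
  have hG := gradSq_nonneg w x
  have hn : (0 : ℝ) ≤ n := Nat.cast_nonneg n
  have hM2 : 1 ≤ M ^ 2 := by nlinarith
  have hM4 : M ^ 2 ≤ M ^ 4 := by nlinarith
  rcases lt_or_ge 4 ‖x‖ with hx | hx
  -- Outside `|x| ≤ 4` no bound on `|x|²` is available, but `χ` and its derivatives vanish there.
  · have e1 : χ x = 0 := image_eq_zero_of_notMem_tsupport (h.notMem_tsupport hx)
    have e2 : euler χ x = 0 := by simp [euler, h.partialDeriv_eq_zero hx]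
    simp only [e1, e2, h.partialDeriv_eq_zero hx, h.lap_eq_zero hx]
    simp only [zero_mul, mul_zero, Finset.sum_const_zero, add_zero, sub_zero, ne_eq,
      OfNat.ofNat_ne_zero, not_false_eq_true, zero_pow]
    positivity
  · have hr0 : 0 ≤ ‖x‖ ^ 2 := sq_nonneg _
    have hr : ‖x‖ ^ 2 ≤ 16 := by nlinarith [norm_nonneg x]
    set r := ‖x‖ ^ 2 with hrdef
    set S := ∑ j, partialDeriv j χ x * partialDeriv j w x with hS
    have hS2 : S ^ 2 ≤ B * gradSq w x := (sum_partialDeriv_mul_sq_le χ w x).trans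
      (mul_le_mul_of_nonneg_right (h.gradSq_le x) hG)
    have hEw : euler w x ^ 2 ≤ 16 * gradSq w x := (euler_sq_le w x).trans
      (mul_le_mul_of_nonneg_right hr hG)
    have hEχ : euler χ x ^ 2 ≤ 16 * B := (euler_sq_le χ x).trans
      (mul_le_mul hr (h.gradSq_le x) (gradSq_nonneg _ _) (by norm_num))
    have hr2 : r ^ 2 ≤ 256 := by nlinarith
    have hτ2 : τ ^ 2 ≤ M ^ 2 := by nlinarith
    have hk2 : k ^ 2 ≤ M ^ 2 := by nlinarith
    set K := 19 + n + 16 * κ with hK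
    -- The summands of `K` are 16 from `r ≤ 16`, `1 + 2 + n` from `τ(τ+2−n)`, and `16κ` from `k² r
    -- q`, each measured in units of `M²`.
    have hc : (r * M ^ 2 + τ * (τ + 2 - n) + k ^ 2 * (r * q x)) ^ 2 ≤ (K * M ^ 2) ^ 2 := by
      have a1 : r * M ^ 2 ≤ 16 * M ^ 2 := mul_le_mul_of_nonneg_right hr (by positivity)
      have a2 : 0 ≤ r * M ^ 2 := by positivity
      have a3 : k ^ 2 * (r * q x) ≤ M ^ 2 * (16 * κ) :=
        mul_le_mul hk2 (mul_le_mul hr (hqκ x) (hq x) (by norm_num))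
          (mul_nonneg hr0 (hq x)) (by positivity)
      have a4 : 0 ≤ k ^ 2 * (r * q x) := by
        have := hq x
        positivity
      have a5 : n * τ ≤ n * M ^ 2 := mul_le_mul_of_nonneg_left (by nlinarith) hn
      have a6 : 0 ≤ n * τ := by positivity
      have a7 : 2 * τ ≤ 2 * M ^ 2 := by nlinarith
      have a8 : 0 ≤ n * M ^ 2 := by positivity
      have a9 : 0 ≤ M ^ 2 * (16 * κ) := by positivity
      apply sq_le_sq'
      · simp only [hK]
        nlinarith
      · simp only [hK]
        nlinarith
    set t₁ := (r * M ^ 2 + τ * (τ + 2 - n) + k ^ 2 * (r * q x)) * (χ x * w x) with ht₁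
    set t₂ := 2 * r * S with ht₂
    set t₃ := r * (lap χ x * w x) with ht₃
    set t₄ := 2 * τ * (χ x * euler w x) with ht₄
    set t₅ := 2 * τ * (euler χ x * w x) with ht₅
    have hw0 : 0 ≤ w x ^ 2 := sq_nonneg _
    have b₁ : t₁ ^ 2 ≤ B * K ^ 2 * (M ^ 4 * w x ^ 2) := by
      have : t₁ ^ 2 = (r * M ^ 2 + τ * (τ + 2 - n) + k ^ 2 * (r * q x)) ^ 2
          * (χ x ^ 2 * w x ^ 2) := by rw [ht₁]; ring
      rw [this]
      refine (mul_le_mul hc (mul_le_mul_of_nonneg_right (h.sq_le x) hw0) (by positivity)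
        (by positivity)).trans (le_of_eq (by ring))
    have b₂ : t₂ ^ 2 ≤ B * 1024 * (M ^ 2 * gradSq w x) := by
      have : t₂ ^ 2 = 4 * r ^ 2 * S ^ 2 := by rw [ht₂]; ring
      rw [this]
      have c1 : 4 * r ^ 2 * S ^ 2 ≤ 4 * 256 * (B * gradSq w x) :=
        mul_le_mul (by linarith) hS2 (sq_nonneg _) (by norm_num)
      have c2 : B * gradSq w x ≤ M ^ 2 * (B * gradSq w x) :=
        le_mul_of_one_le_left (by positivity) hM2
      linarith
    have b₃ : t₃ ^ 2 ≤ B * 256 * (M ^ 4 * w x ^ 2) := by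
      have : t₃ ^ 2 = r ^ 2 * (lap χ x ^ 2 * w x ^ 2) := by rw [ht₃]; ring
      rw [this]
      have c1 : r ^ 2 * (lap χ x ^ 2 * w x ^ 2) ≤ 256 * (B * w x ^ 2) :=
        mul_le_mul hr2 (mul_le_mul_of_nonneg_right (h.lap_sq_le x) hw0) (by positivity)
          (by norm_num)
      have c2 : B * w x ^ 2 ≤ M ^ 4 * (B * w x ^ 2) :=
        le_mul_of_one_le_left (by positivity) (hM2.trans hM4)
      linarith
    have b₄ : t₄ ^ 2 ≤ B * 64 * (M ^ 2 * gradSq w x) := by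
      have : t₄ ^ 2 = 4 * (τ ^ 2 * (χ x ^ 2 * euler w x ^ 2)) := by rw [ht₄]; ring
      rw [this]
      have c1 : τ ^ 2 * (χ x ^ 2 * euler w x ^ 2) ≤ M ^ 2 * (B * (16 * gradSq w x)) :=
        mul_le_mul hτ2 (mul_le_mul (h.sq_le x) hEw (sq_nonneg _) hB) (by positivity)
          (by positivity)
      linarith
    have b₅ : t₅ ^ 2 ≤ B * 64 * (M ^ 4 * w x ^ 2) := by
      have : t₅ ^ 2 = 4 * (τ ^ 2 * (euler χ x ^ 2 * w x ^ 2)) := by rw [ht₅]; ring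
      rw [this]
      have c1 : τ ^ 2 * (euler χ x ^ 2 * w x ^ 2) ≤ M ^ 4 * (16 * B * w x ^ 2) :=
        mul_le_mul (hτ2.trans hM4) (mul_le_mul_of_nonneg_right hEχ hw0) (by positivity)
          (by positivity)
      linarith
    have e : r * (χ x * (M ^ 2 * w x) + 2 * S + lap χ x * w x)
        - 2 * τ * (χ x * euler w x + euler χ x * w x)
        + (τ * (τ + 2 - n) + k ^ 2 * (r * q x)) * (χ x * w x)
        = t₁ + t₂ + t₃ - t₄ - t₅ := by
      rw [ht₁, ht₂, ht₃, ht₄, ht₅]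
      ring
    rw [e]
    exact sq_five_terms_le hB (by positivity) (by positivity) (by positivity) b₁ b₂ b₃ b₄ b₅

end IsAnnularCutoff

/-- The density of the left-hand side of the Carleman estimate. -/
noncomputable def carlemanDensity (τ k : ℝ) (q v : RSpace n → ℝ) (x : RSpace n) : ℝ :=
  τ ^ 2 * v x ^ 2 + ‖x‖ ^ 2 * gradSq v x + τ * k ^ 2 * (‖x‖ ^ 2 * q x * v x ^ 2)

/-- Every coefficient is dominated by a power of `M ≥ 1`, in particular `τk² ≤ M⁴`. Hence the
density of the correction `χw` is controlled by `M²` times the energy density of `w`. -/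
theorem IsAnnularCutoff.carlemanDensity_mul_le {χ : RSpace n → ℝ} {B : ℝ}
    (h : IsAnnularCutoff χ B) {κ M τ k : ℝ} (hκ : 1 ≤ κ) (hτ : 1 ≤ τ)
    (hk : 1 ≤ k) (hτM : τ ≤ M) (hkM : k ≤ M) {q : RSpace n → ℝ} (hq : ∀ x, 0 ≤ q x)
    (hqκ : ∀ x, q x ≤ κ) {w : RSpace n → ℝ} (hw : ContDiff ℝ ∞ w) (x : RSpace n) :
    carlemanDensity τ k q (fun y => χ y * w y) x
      ≤ B * (33 + 16 * κ) * (M ^ 4 * w x ^ 2 + M ^ 2 * gradSq w x) := by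
  have hB := h.nonneg
  have hM : 1 ≤ M := hτ.trans hτM
  have hG := gradSq_nonneg w x
  have hw0 : 0 ≤ w x ^ 2 := sq_nonneg _
  have hM2 : 1 ≤ M ^ 2 := by nlinarith
  have hM4 : M ^ 2 ≤ M ^ 4 := by nlinarith
  rcases lt_or_ge 4 ‖x‖ with hx | hx
  · have e1 : χ x = 0 := image_eq_zero_of_notMem_tsupport (h.notMem_tsupport hx)
    have e2 : gradSq χ x = 0 := by simp [gradSq, h.partialDeriv_eq_zero hx]
    have e3 : gradSq (fun y => χ y * w y) x = 0 := by
      refine le_antisymm ?_ (gradSq_nonneg _ _)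
      have := gradSq_mul_le h.contDiff hw x
      simpa [e1, e2] using this
    simp only [carlemanDensity, e1, e3]
    simp only [zero_mul, mul_zero, add_zero, ne_eq, OfNat.ofNat_ne_zero, not_false_eq_true,
      zero_pow]
    positivity
  · have hr0 : 0 ≤ ‖x‖ ^ 2 := sq_nonneg _
    have hr : ‖x‖ ^ 2 ≤ 16 := by nlinarith [norm_nonneg x]
    set r := ‖x‖ ^ 2 with hrdef
    have hτ2 : τ ^ 2 ≤ M ^ 2 := by nlinarith
    have hk2 : k ^ 2 ≤ M ^ 2 := by nlinarith
    have hχw : (χ x * w x) ^ 2 ≤ B * w x ^ 2 := by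
      rw [mul_pow]
      exact mul_le_mul_of_nonneg_right (h.sq_le x) hw0
    have b1 : τ ^ 2 * (χ x * w x) ^ 2 ≤ M ^ 4 * (B * w x ^ 2) :=
      mul_le_mul (hτ2.trans hM4) hχw (sq_nonneg _) (by positivity)
    have b2 : r * gradSq (fun y => χ y * w y) x
        ≤ 16 * (2 * (B * gradSq w x) + 2 * (B * w x ^ 2)) := by
      refine mul_le_mul hr ?_ (gradSq_nonneg _ _) (by norm_num)
      have := gradSq_mul_le h.contDiff hw x
      have := mul_le_mul_of_nonneg_right (h.sq_le x) hG
      have := mul_le_mul_of_nonneg_right (h.gradSq_le x) hw0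
      nlinarith
    have b3 : τ * k ^ 2 * (r * q x * (χ x * w x) ^ 2) ≤ M ^ 4 * (16 * κ * (B * w x ^ 2)) := by
      refine mul_le_mul ?_ (mul_le_mul (mul_le_mul hr (hqκ x) (hq x) (by norm_num)) hχw
        (sq_nonneg _) (by positivity)) ?_ (by positivity)
      · have : τ * k ^ 2 ≤ M ^ 2 * M ^ 2 :=
          mul_le_mul (by nlinarith) hk2 (sq_nonneg _) (by positivity)
        nlinarith
      · have := hq x
        positivity
    have c1 : B * gradSq w x ≤ M ^ 2 * (B * gradSq w x) :=
      le_mul_of_one_le_left (by positivity) hM2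
    have c2 : B * w x ^ 2 ≤ M ^ 4 * (B * w x ^ 2) :=
      le_mul_of_one_le_left (by positivity) (hM2.trans hM4)
    have z : 0 ≤ B * (1 + 16 * κ) * (M ^ 2 * gradSq w x) := by positivity
    simp only [carlemanDensity]
    nlinarith

theorem carlemanDensity_le_of_sub {τ k : ℝ} (hτ : 0 ≤ τ) {q f g : RSpace n → ℝ}
    (hq : ∀ x, 0 ≤ q x) (hf : ContDiff ℝ ∞ f) (hg : ContDiff ℝ ∞ g) (x : RSpace n) :
    carlemanDensity τ k q f x
      ≤ 2 * carlemanDensity τ k q (fun y => f y - g y) x + 2 * carlemanDensity τ k q g x := by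
  have h1 : f x ^ 2 ≤ 2 * (f x - g x) ^ 2 + 2 * g x ^ 2 := by
    nlinarith [sq_nonneg (f x - 2 * g x)]
  have h2 := mul_le_mul_of_nonneg_left (gradSq_le_of_sub hf hg x) (sq_nonneg ‖x‖)
  have h3 := mul_le_mul_of_nonneg_left h1 (sq_nonneg τ)
  have h4 : 0 ≤ τ * k ^ 2 * (‖x‖ ^ 2 * q x) := by
    have := hq x
    positivity
  have h5 := mul_le_mul_of_nonneg_left h1 h4
  simp only [carlemanDensity]
  nlinarith

end CutoffEstimates

/-! ### Conjugation by the weight `|x|^τ`. -/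

section Conjugation

variable {n : ℕ}

theorem contDiffAt_exp_carlemanWeight (τ : ℝ) {x : RSpace n} (hx : x ≠ 0) :
    ContDiffAt ℝ ∞ (fun y : RSpace n => Real.exp (carlemanWeight τ y)) x := by
  unfold carlemanWeight
  exact (contDiffAt_const.mul ((contDiffAt_norm ℝ hx).log (norm_ne_zero_iff.2 hx))).exp

theorem zero_notMem_annulus : (0 : RSpace n) ∉ annulus n := by
  simp only [annulus, Set.mem_ofPred_eq, norm_zero]
  norm_num

theorem contDiff_exp_carlemanWeight_mul (τ : ℝ) {g : RSpace n → ℝ} (hg : ContDiff ℝ ∞ g)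
    (hs : tsupport g ⊆ annulus n) :
    ContDiff ℝ ∞ (fun x => Real.exp (carlemanWeight τ x) * g x) := by
  refine contDiff_iff_contDiffAt.2 fun x => ?_
  by_cases hx : x = 0
  · have h0 : x ∉ tsupport g := fun h => zero_notMem_annulus (hx ▸ hs h)
    have h1 : (fun y => Real.exp (carlemanWeight τ y) * g y) =ᶠ[nhds x] fun _ => (0 : ℝ) := by
      filter_upwards [notMem_tsupport_iff_eventuallyEq.1 h0] with y hy
      simp [hy]
    exact contDiffAt_const.congr_of_eventuallyEq h1
  · exact (contDiffAt_exp_carlemanWeight τ hx).mul hg.contDiffAt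

theorem partialDeriv_exp_carlemanWeight (τ : ℝ) {x : RSpace n} (hx : x ≠ 0) (j : Fin n) :
    ‖x‖ ^ 2 * partialDeriv j (fun y : RSpace n => Real.exp (carlemanWeight τ y)) x
      = τ * x j * Real.exp (carlemanWeight τ x) := by
  have hx2 : ‖x‖ ^ 2 ≠ 0 := by positivity
  have e : (fun y : RSpace n => Real.exp (carlemanWeight τ y))
      = fun y => Real.exp (τ / 2 * Real.log (‖y‖ ^ 2)) := by
    funext y
    simp only [carlemanWeight, Real.log_pow]
    congr 1
    push_cast
    ring
  have h := ((((hasStrictFDerivAt_norm_sq x).hasFDerivAt).log hx2).const_mul (τ / 2)).exp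
  have h' : partialDeriv j (fun y : RSpace n => Real.exp (carlemanWeight τ y)) x
      = Real.exp (carlemanWeight τ x) * (τ / 2 * ((‖x‖ ^ 2)⁻¹ * (2 * x j))) := by
    rw [congrFun e x, e]
    unfold partialDeriv
    rw [h.fderiv]
    simp [EuclideanSpace.inner_single_right]
  rw [h']
  field_simp

/-- The factor `|x|²` clears the denominator of `∇φ = τ x/|x|²`. The identity then also holds at the
origin and can be differentiated without division. -/
theorem norm_sq_mul_partialDeriv_exp_carlemanWeight_mul (τ : ℝ) {g : RSpace n → ℝ}
    (hg : ContDiff ℝ ∞ g) (j : Fin n) (x : RSpace n) :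
    ‖x‖ ^ 2 * partialDeriv j (fun y => Real.exp (carlemanWeight τ y) * g y) x
      = ‖x‖ ^ 2 * (Real.exp (carlemanWeight τ x) * partialDeriv j g x)
        + τ * x j * (Real.exp (carlemanWeight τ x) * g x) := by
  by_cases hx : x = 0
  · simp [hx]
  · rw [partialDeriv_mul ((contDiffAt_exp_carlemanWeight τ hx).differentiableAt (by simp))
      (hg.differentiable (by simp) x), mul_add, ← mul_assoc _ _ (g x),
      partialDeriv_exp_carlemanWeight τ hx]
    ring

theorem tsupport_partialDeriv_subset {g : RSpace n → ℝ} (j : Fin n) :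
    tsupport (partialDeriv j g) ⊆ tsupport g :=
  tsupport_fderiv_apply_subset ℝ _

theorem conjugatedOperator_exp_carlemanWeight_mul (τ k : ℝ) (q : RSpace n → ℝ)
    {u : RSpace n → ℝ} (hu : ContDiff ℝ ∞ u) (hs : tsupport u ⊆ annulus n) (x : RSpace n) :
    conjugatedOperator τ k q (fun y => Real.exp (carlemanWeight τ y) * u y) x
      = ‖x‖ ^ 2 * (Real.exp (carlemanWeight τ x) * (lap u x + k ^ 2 * (q x * u x))) := by
  set v : RSpace n → ℝ := fun y => Real.exp (carlemanWeight τ y) * u y with hv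
  have cv : ContDiff ℝ ∞ v := contDiff_exp_carlemanWeight_mul τ hu hs
  let p : Fin n → RSpace n → ℝ := fun j y => Real.exp (carlemanWeight τ y) * partialDeriv j u y
  have cp : ∀ j, ContDiff ℝ ∞ (p j) := fun j =>
    contDiff_exp_carlemanWeight_mul τ (contDiff_partialDeriv hu j)
      ((tsupport_partialDeriv_subset j).trans hs)
  have hN : ContDiff ℝ ∞ (fun x : RSpace n => ‖x‖ ^ 2) := contDiff_norm_sq ℝ
  have hX := fun j => contDiff_coord (n := n) j (m := ∞)
  have d : ∀ {g : RSpace n → ℝ}, ContDiff ℝ ∞ g → ∀ x, DifferentiableAt ℝ g x :=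
    fun hg x => hg.differentiable (by simp) x
  have s1 : ∀ j y, ‖y‖ ^ 2 * partialDeriv j v y = ‖y‖ ^ 2 * p j y + τ * (y j * v y) :=
    fun j y => by
      rw [norm_sq_mul_partialDeriv_exp_carlemanWeight_mul τ hu j y]
      ring
  have s2 : ∀ j, ‖x‖ ^ 2 * partialDeriv j (p j) x
      = ‖x‖ ^ 2 * (Real.exp (carlemanWeight τ x) * partialDeriv j (partialDeriv j u) x)
        + τ * x j * p j x := fun j =>
    norm_sq_mul_partialDeriv_exp_carlemanWeight_mul τ (contDiff_partialDeriv hu j) j x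
  -- Second derivatives come from differentiating the identity `s1` between smooth functions,
  -- followed by `s2`.
  have s3 : ∀ j, ‖x‖ ^ 2 * partialDeriv j (partialDeriv j v) x
      = Real.exp (carlemanWeight τ x) * ‖x‖ ^ 2 * partialDeriv j (partialDeriv j u) x
        + (2 + τ) * (x j * p j x) + τ * v x + (τ - 2) * (x j * partialDeriv j v x) := by
    intro j
    have h : partialDeriv j (fun y => ‖y‖ ^ 2 * partialDeriv j v y) x
        = partialDeriv j (fun y => ‖y‖ ^ 2 * p j y + τ * (y j * v y)) x := by
      rw [funext (s1 j)]
    have cD := contDiff_partialDeriv cv j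
    rw [partialDeriv_mul (d hN x) (d cD x), partialDeriv_add (d (hN.mul (cp j)) x)
      (d (contDiff_const.mul ((hX j).mul cv)) x), partialDeriv_mul (d hN x) (d (cp j) x),
      partialDeriv_const_mul (d ((hX j).mul cv) x), partialDeriv_mul (d (hX j) x) (d cv x),
      s2, partialDeriv_norm_sq, partialDeriv_coord] at h
    simp only [if_true] at h
    linarith
  -- Contraction of `s1` with `x`, using `Σ x_j² = |x|²`. Cancelling `|x|²` requires `x ≠ 0`; at the
  -- origin `v` vanishes.
  have s4 : ∑ j, x j * p j x = euler v x - τ * v x := by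
    by_cases hx : x = 0
    · have : v x = 0 := by
        have h0 : x ∉ tsupport u := fun h => zero_notMem_annulus (hx ▸ hs h)
        simp [hv, image_eq_zero_of_notMem_tsupport h0]
      rw [this]
      simp [hx, euler]
    · have hx2 : ‖x‖ ^ 2 ≠ 0 := by positivity
      apply mul_left_cancel₀ hx2
      have : ∀ j, ‖x‖ ^ 2 * (x j * p j x)
          = ‖x‖ ^ 2 * (x j * partialDeriv j v x) - τ * v x * x j ^ 2 := fun j => by
        linear_combination (-x j) * s1 j x
      rw [Finset.mul_sum, Finset.sum_congr rfl fun j _ => this j, Finset.sum_sub_distrib,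
        ← Finset.mul_sum, ← Finset.mul_sum, ← norm_sq_eq_sum, euler]
      ring
  have s5 : ‖x‖ ^ 2 * lap v x = Real.exp (carlemanWeight τ x) * ‖x‖ ^ 2 * lap u x
      + (2 + τ) * (∑ j, x j * p j x) + n * (τ * v x) + (τ - 2) * euler v x := by
    simp only [lap, euler, Finset.mul_sum, s3, Finset.sum_add_distrib]
    simp
  rw [conjugatedOperator, s5, s4]
  simp only [hv]
  ring

end Conjugation

/-! ### Smooth solutions with a divergence source. -/

section SmoothEstimate

variable {n : ℕ}

theorem hasCompactSupport_of_tsupport_subset_annulus {g : RSpace n → ℝ}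
    (hs : tsupport g ⊆ annulus n) : HasCompactSupport g :=
  hasCompactSupport_of_norm_le (r := 2) fun _ hx => (hs (subset_tsupport g hx)).2.le

theorem continuous_carlemanDensity {τ k : ℝ} {q v : RSpace n → ℝ} (hq : Continuous q)
    (hv : ContDiff ℝ ∞ v) : Continuous (carlemanDensity τ k q v) := by
  unfold carlemanDensity
  have := (contDiff_gradSq hv).continuous
  have := hv.continuous
  fun_prop

theorem HasCompactSupport.sq {f : RSpace n → ℝ} (hc : HasCompactSupport f) :
    HasCompactSupport (fun x => f x ^ 2) := by
  simp only [pow_two]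
  exact hc.mul_left

theorem HasCompactSupport.carlemanDensity {τ k : ℝ} {q v : RSpace n → ℝ}
    (hc : HasCompactSupport v) : HasCompactSupport (carlemanDensity τ k q v) :=
  (hc.sq.mul_left.add hc.gradSq.mul_left).add hc.sq.mul_left.mul_left

theorem integral_carlemanDensity_le {τ k : ℝ} (hτ : 1 ≤ τ) {q v : RSpace n → ℝ}
    (hq : ContDiff ℝ 1 q) (hq0 : ∀ x, 0 ≤ q x) (hq1 : ∀ x, 0 ≤ euler q x)
    (hv : ContDiff ℝ ∞ v) (hc : HasCompactSupport v)
    (hs : ∀ x, v x ≠ 0 → 1 / 2 ≤ ‖x‖ ∧ ‖x‖ ≤ 4) :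
    ∫ x, carlemanDensity τ k q v x
      ≤ 1024 * (n + 5) * ∫ x, conjugatedOperator τ k q v x ^ 2 := by
  have cv := hv.continuous
  have cq := hq.continuous
  have cG := (contDiff_gradSq hv).continuous
  have iv := integrable_sq_of_hasCompactSupport cv hc
  have iQ : Integrable (fun x => ‖x‖ ^ 2 * q x * v x ^ 2) :=
    Continuous.integrable_of_hasCompactSupport (by fun_prop) hc.sq.mul_left
  have iG : Integrable (fun x => ‖x‖ ^ 2 * gradSq v x) :=
    Continuous.integrable_of_hasCompactSupport (by fun_prop) hc.gradSq.mul_left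
  have h := carleman_smooth (k := k) hτ hq hq0 hq1 hv hc hs
  simp only [_root_.carlemanDensity]
  rwa [integral_add ((iv.const_mul _).fun_add iG) (iQ.const_mul _),
    integral_add (iv.const_mul _) iG, integral_const_mul, integral_const_mul]

/-- With `v = e^φ u` one has `e^φ∇u = ∇v − τ|x|⁻² v x` away from the origin. The weight `|x|²` turns
the second term into `τ²v²`, which the estimate already controls. -/
theorem exp_carlemanWeight_gradient_sq_le (τ : ℝ) {u : RSpace n → ℝ} (hu : ContDiff ℝ ∞ u)
    (x : RSpace n) :
    ‖x‖ ^ 2 * (∑ j, (Real.exp (carlemanWeight τ x) * partialDeriv j u x) ^ 2)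
      ≤ 2 * (‖x‖ ^ 2 * gradSq (fun y => Real.exp (carlemanWeight τ y) * u y) x)
        + 2 * (τ ^ 2 * (Real.exp (carlemanWeight τ x) * u x) ^ 2) := by
  set v : RSpace n → ℝ := fun y => Real.exp (carlemanWeight τ y) * u y with hv
  by_cases hx : x = 0
  · rw [hx]
    simp only [norm_zero, ne_eq, OfNat.ofNat_ne_zero, not_false_eq_true, zero_pow, zero_mul,
      mul_zero, zero_add]
    positivity
  have hx2 : 0 < ‖x‖ ^ 2 := by positivity
  refine le_of_mul_le_mul_left ?_ hx2
  have s1 : ∀ j, ‖x‖ ^ 2 * (‖x‖ ^ 2 * (Real.exp (carlemanWeight τ x) * partialDeriv j u x) ^ 2)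
      ≤ ‖x‖ ^ 2 * (2 * (‖x‖ ^ 2 * partialDeriv j v x ^ 2))
        + 2 * (τ ^ 2 * v x ^ 2) * x j ^ 2 := by
    intro j
    have h := norm_sq_mul_partialDeriv_exp_carlemanWeight_mul τ hu j x
    have h' : ‖x‖ ^ 2 * (Real.exp (carlemanWeight τ x) * partialDeriv j u x)
        = ‖x‖ ^ 2 * partialDeriv j v x - τ * x j * v x := by
      simp only [hv]
      linarith
    have h2 : ‖x‖ ^ 2 * (‖x‖ ^ 2 * (Real.exp (carlemanWeight τ x) * partialDeriv j u x) ^ 2)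
        = (‖x‖ ^ 2 * partialDeriv j v x - τ * x j * v x) ^ 2 := by
      rw [← h']
      ring
    rw [h2]
    linarith [sq_nonneg (‖x‖ ^ 2 * partialDeriv j v x + τ * x j * v x)]
  have := Finset.sum_le_sum fun j (_ : j ∈ Finset.univ) => s1 j
  simp only [Finset.sum_add_distrib, ← Finset.mul_sum, ← norm_sq_eq_sum] at this
  simp only [gradSq]
  calc _ ≤ _ := this
    _ = _ := by ring

set_option maxHeartbeats 2000000 in
/-- The Carleman estimate for smooth functions, with a divergence on the right-hand side. -/
theorem carleman_smooth_divergence (n : ℕ) {κ : ℝ} (hκ : 1 < κ) :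
    ∃ C : ℝ, 0 < C ∧ ∀ (τ k : ℝ), 1 ≤ τ → 1 ≤ k → ∀ q : RSpace n → ℝ,
      IsAdmissibleCoefficient κ q → ∀ (u : RSpace n → ℝ) (F : Fin n → RSpace n → ℝ),
      ContDiff ℝ ∞ u → tsupport u ⊆ annulus n →
      (∀ j, ContDiff ℝ ∞ (F j)) → (∀ j, tsupport (F j) ⊆ annulus n) →
      ∫ x, (τ ^ 2 * (Real.exp (carlemanWeight τ x) * u x) ^ 2
          + ‖x‖ ^ 2 * (∑ j, (Real.exp (carlemanWeight τ x) * partialDeriv j u x) ^ 2)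
          + τ * k ^ 2 * (‖x‖ ^ 2 * q x * (Real.exp (carlemanWeight τ x) * u x) ^ 2))
        ≤ C * ((∫ x, (‖x‖ ^ 2 * (Real.exp (carlemanWeight τ x)
            * (lap u x + k ^ 2 * (q x * u x) - ∑ j, partialDeriv j (F j) x))) ^ 2)
          + max τ k ^ 2 * ∑ j, ∫ x, (Real.exp (carlemanWeight τ x) * F j x) ^ 2) := by
  obtain ⟨χ, B, hχ⟩ := exists_isAnnularCutoff n
  have hB := hχ.nonneg
  have hn : (0 : ℝ) ≤ n := Nat.cast_nonneg n
  set C₁ : ℝ := 5 * B * ((19 + n + 16 * κ) ^ 2 + 1088) with hC₁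
  set C₂ : ℝ := B * (33 + 16 * κ) with hC₂
  have hC₁0 : 0 ≤ C₁ := by positivity
  have hC₂0 : 0 ≤ C₂ := by positivity
  -- The factor 6 is 3, for passing from `e^φ∇u` to `∇v`, times 2, for splitting `v = v₂ + χw`. The
  -- constant `15 + 3C₁` dominates the coefficients 3 and `12 + 3C₁` of `∫g²` and `M²S`; `C₂` pays
  -- for `χw`.
  refine ⟨6 * (1024 * (n + 5)) * (15 + 3 * C₁) + 6 * C₂, by positivity, ?_⟩
  intro τ k hτ hk q hq u F hu hus hF hFs
  have hq0 : ∀ x, 0 ≤ q x := fun x => (by positivity : (0 : ℝ) ≤ κ⁻¹).trans (hq.lower x)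
  have hq1 : ∀ x, 0 ≤ euler q x := fun x => by
    rw [euler, ← fderiv_self_eq_sum]
    exact hq.radially_monotone x
  have cq := hq.contDiff.continuous
  set M := max τ k with hM
  have hτM : τ ≤ M := le_max_left _ _
  have hkM : k ≤ M := le_max_right _ _
  have hM0 : 0 < M := by linarith
  let H : Fin n → RSpace n → ℝ := fun j x => Real.exp (carlemanWeight τ x) * F j x
  have hH : ∀ j, ContDiff ℝ ∞ (H j) := fun j =>
    contDiff_exp_carlemanWeight_mul τ (hF j) (hFs j)
  have hHs : ∀ j, tsupport (H j) ⊆ tsupport (F j) := fun j => tsupport_mul_subset_right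
  have hHa : ∀ j, tsupport (H j) ⊆ annulus n := fun j => (hHs j).trans (hFs j)
  have hHc : ∀ j, HasCompactSupport (H j) := fun j =>
    hasCompactSupport_of_tsupport_subset_annulus (hHa j)
  obtain ⟨w, cw, hw, iw, iG, hE⟩ := exists_resolvent_divergence hM0 hH hHc
  set v : RSpace n → ℝ := fun x => Real.exp (carlemanWeight τ x) * u x with hv
  have cv : ContDiff ℝ ∞ v := contDiff_exp_carlemanWeight_mul τ hu hus
  have hvs : tsupport v ⊆ annulus n := tsupport_mul_subset_right.trans hus
  have hvc : HasCompactSupport v := hasCompactSupport_of_tsupport_subset_annulus hvs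
  let z : RSpace n → ℝ := fun x => χ x * w x
  have cz : ContDiff ℝ ∞ z := hχ.contDiff.mul cw
  have hzc : HasCompactSupport z := hχ.hasCompactSupport.mul_right
  let v₂ : RSpace n → ℝ := fun x => v x - z x
  have cv₂ : ContDiff ℝ ∞ v₂ := cv.sub cz
  have hv₂c : HasCompactSupport v₂ := hvc.sub hzc
  have hv₂s : ∀ x, v₂ x ≠ 0 → 1 / 2 ≤ ‖x‖ ∧ ‖x‖ ≤ 4 := by
    intro x hx
    by_cases h : χ x = 0
    · have : v x ≠ 0 := by
        intro h'
        simp [v₂, z, h, h'] at hx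
      have := hvs (subset_tsupport _ this)
      exact ⟨by linarith [this.1], by linarith [this.2]⟩
    · exact hχ.support x h
  -- Since `χ = 1` on the support of `H`, the cutoff leaves the divergence intact.
  have hdiv : ∀ x, χ x * (∑ j, partialDeriv j (H j) x) = ∑ j, partialDeriv j (H j) x := by
    intro x
    by_cases h : x ∈ annulus n
    · rw [hχ.eq_one x h.1.le h.2.le, one_mul]
    · have : ∀ j, partialDeriv j (H j) x = 0 := fun j =>
        partialDeriv_eq_zero_of_notMem_tsupport (fun h' => h (hHa j h')) j
      simp [this]
  -- `g` is the weighted `L²` part of the source. The term `τ x·H` arises because the weight does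
  -- not commute with the divergence; on the annulus its square is at most `4M²|H|²`.
  let g : RSpace n → ℝ := fun x => conjugatedOperator τ k q v x
    - ‖x‖ ^ 2 * (∑ j, partialDeriv j (H j) x) + τ * ∑ j, x j * H j x
  have hg : ∀ x, g x = ‖x‖ ^ 2 * (Real.exp (carlemanWeight τ x)
      * (lap u x + k ^ 2 * (q x * u x) - ∑ j, partialDeriv j (F j) x)) := by
    intro x
    have h1 := conjugatedOperator_exp_carlemanWeight_mul τ k q hu hus x
    have h2 : ‖x‖ ^ 2 * (∑ j, partialDeriv j (H j) x)
        = ‖x‖ ^ 2 * (Real.exp (carlemanWeight τ x) * ∑ j, partialDeriv j (F j) x)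
          + τ * ∑ j, x j * H j x := by
      simp only [Finset.mul_sum, ← Finset.sum_add_distrib]
      refine Finset.sum_congr rfl fun j _ => ?_
      rw [norm_sq_mul_partialDeriv_exp_carlemanWeight_mul τ (hF j) j x]
      simp only [H]
      ring
    simp only [g, h1, h2, hv]
    ring
  have cg : Continuous g := by
    have h1 := continuous_conjugatedOperator (τ := τ) (k := k) cq cv
    have h2 : ∀ j, Continuous (partialDeriv j (H j)) := fun j =>
      (contDiff_partialDeriv (hH j) j).continuous
    have h3 : ∀ j, Continuous (H j) := fun j => (hH j).continuous
    fun_prop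
  have hgc : HasCompactSupport g := by
    refine (hvc.conjugatedOperator.sub ?_).add ?_
    · exact (hasCompactSupport_finset_sum _ fun j => (hHc j).partialDeriv j).mul_left
    · exact (hasCompactSupport_finset_sum _ fun j => (hHc j).mul_left).mul_left
  have ig := integrable_sq_of_hasCompactSupport cg hgc
  have iH : ∀ j, Integrable (fun x => H j x ^ 2) := fun j =>
    integrable_sq_of_hasCompactSupport (hH j).continuous (hHc j)
  have iHs : Integrable (fun x => ∑ j, H j x ^ 2) := integrable_finsetSum _ fun j _ => iH j
  have iZ : Integrable (fun x => M ^ 4 * w x ^ 2 + M ^ 2 * gradSq w x) :=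
    (iw.const_mul _).fun_add (iG.const_mul _)
  set S := ∑ j, ∫ x, H j x ^ 2 with hS
  have hS' : ∫ x, ∑ j, H j x ^ 2 = S := integral_finsetSum _ fun j _ => iH j
  have hS0 : 0 ≤ S := Finset.sum_nonneg fun j _ => integral_sq_nonneg _
  set Z := ∫ x, (M ^ 4 * w x ^ 2 + M ^ 2 * gradSq w x) with hZ
  have hZS : Z ≤ M ^ 2 * S := by
    rw [hZ, integral_add (iw.const_mul _) (iG.const_mul _), integral_const_mul,
      integral_const_mul]
    have := mul_le_mul_of_nonneg_left hE (sq_nonneg M)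
    linarith
  have hP : ∀ x, conjugatedOperator τ k q v₂ x ^ 2
      ≤ 3 * g x ^ 2 + 12 * M ^ 2 * (∑ j, H j x ^ 2)
        + 3 * C₁ * (M ^ 4 * w x ^ 2 + M ^ 2 * gradSq w x) := by
    intro x
    have hR := hχ.remainder_sq_le hκ.le hτ hk hτM hkM hq0 hq.upper w x
    have hxH : τ ^ 2 * (∑ j, x j * H j x) ^ 2 ≤ 4 * M ^ 2 * ∑ j, H j x ^ 2 := by
      have h0 : 0 ≤ ∑ j, H j x ^ 2 := Finset.sum_nonneg fun j _ => sq_nonneg _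
      have h1 : (∑ j, x j * H j x) ^ 2 ≤ 4 * ∑ j, H j x ^ 2 := by
        by_cases h : x ∈ annulus n
        · have h2 : (∑ j, x j * H j x) ^ 2 ≤ ‖x‖ ^ 2 * ∑ j, H j x ^ 2 := by
            rw [norm_sq_eq_sum]
            exact Finset.sum_mul_sq_le_sq_mul_sq _ _ _
          refine h2.trans (mul_le_mul_of_nonneg_right ?_ h0)
          have := h.2
          nlinarith [norm_nonneg x]
        · have : ∀ j, H j x = 0 := fun j =>
            image_eq_zero_of_notMem_tsupport (fun h' => h (hHa j h'))
          simp [this]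
      have h2 : τ ^ 2 ≤ M ^ 2 := by nlinarith
      calc _ ≤ M ^ 2 * (4 * ∑ j, H j x ^ 2) := mul_le_mul h2 h1 (sq_nonneg _) (sq_nonneg _)
        _ = _ := by ring
    set R := ‖x‖ ^ 2 * (χ x * (M ^ 2 * w x) + 2 * (∑ j, partialDeriv j χ x * partialDeriv j w x)
        + lap χ x * w x)
      - 2 * τ * (χ x * euler w x + euler χ x * w x)
      + (τ * (τ + 2 - n) + k ^ 2 * (‖x‖ ^ 2 * q x)) * (χ x * w x) with hRdef
    -- The two copies of `|x|² div H` cancel, one from `v` and one from `Δw`, leaving only terms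
    -- without derivatives of `H`.
    have h1 : conjugatedOperator τ k q v₂ x = g x - τ * (∑ j, x j * H j x) - R := by
      have e1 : conjugatedOperator τ k q v₂ x
          = conjugatedOperator τ k q v x - conjugatedOperator τ k q z x :=
        conjugatedOperator_sub cv cz x
      have e2 : conjugatedOperator τ k q z x
          = ‖x‖ ^ 2 * (∑ j, partialDeriv j (H j) x) + R := by
        rw [← hdiv x]
        simp only [conjugatedOperator, z, lap_mul hχ.contDiff cw, euler_mul hχ.contDiff cw, hw,
          hRdef]
        ring
      rw [e1, e2]
      simp only [g]
      ring
    rw [h1]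
    have h3 : (g x - τ * (∑ j, x j * H j x) - R) ^ 2
        ≤ 3 * g x ^ 2 + 3 * (τ ^ 2 * (∑ j, x j * H j x) ^ 2) + 3 * R ^ 2 := by
      generalize g x = a
      generalize (∑ j, x j * H j x) = b
      generalize R = c
      linarith [sq_nonneg (a + τ * b), sq_nonneg (a + c), sq_nonneg (τ * b - c)]
    linarith
  have hP' : ∫ x, conjugatedOperator τ k q v₂ x ^ 2
      ≤ 3 * (∫ x, g x ^ 2) + 12 * M ^ 2 * S + 3 * C₁ * Z := by
    have := integral_mono (integrable_sq_of_hasCompactSupport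
      (continuous_conjugatedOperator cq cv₂) hv₂c.conjugatedOperator)
      (((ig.const_mul 3).fun_add (iHs.const_mul (12 * M ^ 2))).fun_add (iZ.const_mul (3 * C₁))) hP
    rwa [integral_add ((ig.const_mul 3).fun_add (iHs.const_mul (12 * M ^ 2)))
      (iZ.const_mul (3 * C₁)), integral_add (ig.const_mul 3) (iHs.const_mul (12 * M ^ 2)),
      integral_const_mul, integral_const_mul, integral_const_mul, hS', ← hZ] at this
  have hD := integral_carlemanDensity_le (k := k) hτ hq.contDiff hq0 hq1 cv₂ hv₂c hv₂s
  have iD : Integrable (carlemanDensity τ k q v₂) :=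
    (continuous_carlemanDensity cq cv₂).integrable_of_hasCompactSupport hv₂c.carlemanDensity
  have hL : ∫ x, (τ ^ 2 * (Real.exp (carlemanWeight τ x) * u x) ^ 2
          + ‖x‖ ^ 2 * (∑ j, (Real.exp (carlemanWeight τ x) * partialDeriv j u x) ^ 2)
          + τ * k ^ 2 * (‖x‖ ^ 2 * q x * (Real.exp (carlemanWeight τ x) * u x) ^ 2))
      ≤ 6 * (∫ x, carlemanDensity τ k q v₂ x) + 6 * C₂ * Z := by
    rw [hZ, ← integral_const_mul, ← integral_const_mul,
      ← integral_add (iD.const_mul 6) (iZ.const_mul (6 * C₂))]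
    refine integral_mono_of_nonneg (Filter.Eventually.of_forall fun x => ?_)
      ((iD.const_mul 6).add (iZ.const_mul (6 * C₂))) (Filter.Eventually.of_forall fun x => ?_)
    · have := hq0 x
      simp only [Pi.zero_apply]
      positivity
    · have h1 := exp_carlemanWeight_gradient_sq_le τ hu x
      have h2 := carlemanDensity_le_of_sub (k := k) (by linarith : 0 ≤ τ) hq0 cv cz x
      have h3 : carlemanDensity τ k q z x ≤ C₂ * (M ^ 4 * w x ^ 2 + M ^ 2 * gradSq w x) :=
        hχ.carlemanDensity_mul_le hκ.le hτ hk hτM hkM hq0 hq.upper cw x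
      have h4 : carlemanDensity τ k q v x = τ ^ 2 * v x ^ 2 + ‖x‖ ^ 2 * gradSq v x
        + τ * k ^ 2 * (‖x‖ ^ 2 * q x * v x ^ 2) := rfl
      have h5 : 0 ≤ ‖x‖ ^ 2 * gradSq v x := mul_nonneg (sq_nonneg _) (gradSq_nonneg _ _)
      have h6 : 0 ≤ τ * k ^ 2 * (‖x‖ ^ 2 * q x * v x ^ 2) := by
        have := hq0 x
        positivity
      have h7 : v x = Real.exp (carlemanWeight τ x) * u x := rfl
      simp only
      rw [← h7] at h1 ⊢
      linarith
  have hg2 : ∫ x, g x ^ 2 = ∫ x, (‖x‖ ^ 2 * (Real.exp (carlemanWeight τ x)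
      * (lap u x + k ^ 2 * (q x * u x) - ∑ j, partialDeriv j (F j) x))) ^ 2 := by
    simp only [hg]
  rw [← hg2]
  refine hL.trans ?_
  have hg0 : 0 ≤ ∫ x, g x ^ 2 := integral_sq_nonneg _
  set Γ := ∫ x, g x ^ 2
  have hT : ∫ x, carlemanDensity τ k q v₂ x
      ≤ 1024 * (n + 5) * (3 * Γ + (12 + 3 * C₁) * (M ^ 2 * S)) := by
    refine hD.trans (mul_le_mul_of_nonneg_left (hP'.trans ?_) (by positivity))
    linarith [mul_le_mul_of_nonneg_left hZS (by positivity : 0 ≤ 3 * C₁)]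
  have hT2 := mul_le_mul_of_nonneg_left hZS (by positivity : 0 ≤ 6 * C₂)
  have hMS : 0 ≤ M ^ 2 * S := by positivity
  have t1 : 3 * Γ + (12 + 3 * C₁) * (M ^ 2 * S) ≤ (15 + 3 * C₁) * (Γ + M ^ 2 * S) := by
    linarith [mul_nonneg hC₁0 hg0]
  have t2 := mul_le_mul_of_nonneg_left t1 (by positivity : (0 : ℝ) ≤ 1024 * (n + 5))
  linarith [mul_nonneg hC₂0 hg0]

end SmoothEstimate

/-! ### Mollifiers and Young's inequality. -/

section Mollification

open scoped ENNReal

variable {n : ℕ}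

/-- `ρ` is a smooth probability density supported in the closed ball of radius `ε`. -/
structure IsMollifier (ρ : RSpace n → ℝ) (ε : ℝ) : Prop where
  contDiff : ContDiff ℝ ∞ ρ
  nonneg : ∀ x, 0 ≤ ρ x
  integral_eq_one : ∫ x, ρ x = 1
  norm_le : ∀ x, ρ x ≠ 0 → ‖x‖ ≤ ε

theorem ContDiffBump.isMollifier (φ : ContDiffBump (0 : RSpace n)) :
    IsMollifier (φ.normed volume) φ.rOut where
  contDiff := φ.contDiff_normed
  nonneg := φ.nonneg_normed
  integral_eq_one := φ.integral_normed
  norm_le x hx := by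
    have : x ∈ Function.support (φ.normed volume) := hx
    rw [φ.support_normed_eq] at this
    simpa using (Metric.mem_ball.1 this).le

/-- The convolution `ρ * g`. -/
noncomputable def mollify (ρ g : RSpace n → ℝ) (x : RSpace n) : ℝ := ∫ y, ρ (x - y) * g y

theorem mollify_eq_convolution (ρ g : RSpace n → ℝ) :
    mollify ρ g = convolution ρ g (ContinuousLinearMap.lsmul ℝ ℝ) volume := by
  funext x
  rw [convolution_lsmul_swap]
  rfl

theorem contDiff_mollify {ρ g : RSpace n → ℝ} (hρ : ContDiff ℝ ∞ ρ) (hc : HasCompactSupport ρ)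
    (hg : LocallyIntegrable g volume) : ContDiff ℝ ∞ (mollify ρ g) := by
  rw [mollify_eq_convolution]
  exact hc.contDiff_convolution_left _ hρ hg

theorem hasCompactSupport_comp_sub {ρ : RSpace n → ℝ} (hc : HasCompactSupport ρ)
    (x : RSpace n) : HasCompactSupport (fun y => ρ (x - y)) :=
  hc.comp_homeomorph (Homeomorph.subLeft x)

theorem integrable_mollify_integrand {ρ g : RSpace n → ℝ} (hρ : Continuous ρ)
    (hc : HasCompactSupport ρ) (hg : LocallyIntegrable g volume) (x : RSpace n) :
    Integrable (fun y => ρ (x - y) * g y) := by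
  have := hg.integrable_smul_left_of_hasCompactSupport
    (hρ.comp (continuous_const.sub continuous_id) : Continuous fun y => ρ (x - y))
    (hasCompactSupport_comp_sub hc x)
  simpa using this

theorem partialDeriv_mollify {ρ g : RSpace n → ℝ} (hρ : ContDiff ℝ ∞ ρ)
    (hc : HasCompactSupport ρ) (hg : LocallyIntegrable g volume) (j : Fin n) :
    partialDeriv j (mollify ρ g) = mollify (partialDeriv j ρ) g := by
  funext x
  have h := hc.hasFDerivAt_convolution_left (ContinuousLinearMap.lsmul ℝ ℝ)
    (hρ.of_le (by simp)) hg x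
  rw [← mollify_eq_convolution] at h
  unfold partialDeriv
  rw [h.fderiv, convolution_eq_swap]
  have hi : Integrable (fun y => ((ContinuousLinearMap.lsmul ℝ ℝ).precompL (RSpace n))
      (fderiv ℝ ρ (x - y)) (g y)) := by
    have h1 : ConvolutionExistsAt (fderiv ℝ ρ) g x
        ((ContinuousLinearMap.lsmul ℝ ℝ).precompL (RSpace n)) volume :=
      (hc.fderiv ℝ).convolutionExists_left _ (hρ.continuous_fderiv (by simp)) hg x
    exact h1.integrable_swap
  exact ContinuousLinearMap.integral_apply hi _

theorem partialDeriv_comp_sub {ρ : RSpace n → ℝ} (hρ : ContDiff ℝ ∞ ρ) (x y : RSpace n)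
    (j : Fin n) : partialDeriv j (fun z => ρ (x - z)) y = -partialDeriv j ρ (x - y) := by
  have h : HasFDerivAt (fun z => ρ (x - z)) _ y :=
    (hρ.differentiable (by simp) (x - y)).hasFDerivAt.comp y ((hasFDerivAt_id y).const_sub x)
  unfold partialDeriv
  rw [h.fderiv]
  simp

theorem isTestFunction_comp_sub {ρ : RSpace n → ℝ} (hρ : ContDiff ℝ ∞ ρ)
    (hc : HasCompactSupport ρ) (x : RSpace n) : IsTestFunction (fun y => ρ (x - y)) :=
  ⟨hρ.comp (contDiff_const.sub contDiff_id), hasCompactSupport_comp_sub hc x⟩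

namespace IsMollifier

variable {ρ : RSpace n → ℝ} {ε : ℝ}

theorem hasCompactSupport (h : IsMollifier ρ ε) : HasCompactSupport ρ :=
  hasCompactSupport_of_norm_le h.norm_le

theorem integrable (h : IsMollifier ρ ε) : Integrable ρ :=
  h.contDiff.continuous.integrable_of_hasCompactSupport h.hasCompactSupport

theorem lintegral_eq_one (h : IsMollifier ρ ε) : ∫⁻ x, ‖ρ x‖ₑ = 1 := by
  have h1 := ofReal_integral_eq_lintegral_ofReal h.integrable (Filter.Eventually.of_forall h.nonneg)
  rw [h.integral_eq_one, ENNReal.ofReal_one] at h1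
  rw [h1]
  exact lintegral_congr fun x => Real.enorm_of_nonneg (h.nonneg x)

/-- Young's inequality for a function dominated by the average of `A`. -/
theorem eLpNorm_le_of_enorm_le (h : IsMollifier ρ ε) {A : RSpace n → ℝ≥0∞}
    (hA : AEMeasurable A volume) {c : ℝ≥0∞} (hc : c ≠ ⊤) {g : RSpace n → ℝ}
    (hg : ∀ x, ‖g x‖ₑ ≤ c * ∫⁻ y, ‖ρ (x - y)‖ₑ * A y) :
    eLpNorm g 2 volume ≤ c * (∫⁻ y, A y ^ (2 : ℝ)) ^ (1 / 2 : ℝ) := by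
  have mρ : Measurable fun x => ‖ρ x‖ₑ := h.contDiff.continuous.measurable.enorm
  have one : ∀ x, ∫⁻ y, ‖ρ (x - y)‖ₑ = 1 := fun x => by
    rw [lintegral_sub_left_eq_self (fun y => ‖ρ y‖ₑ) x, h.lintegral_eq_one]
  -- Cauchy–Schwarz for the probability measure `ρ(x−y) dy`, with the kernel split into two square
  -- roots.
  have cs : ∀ x, (∫⁻ y, ‖ρ (x - y)‖ₑ * A y) ^ (2 : ℝ)
      ≤ ∫⁻ y, ‖ρ (x - y)‖ₑ * A y ^ (2 : ℝ) := by
    intro x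
    have mx : Measurable fun y => ‖ρ (x - y)‖ₑ := mρ.comp (measurable_const.sub measurable_id)
    have hr : ∀ y, ‖ρ (x - y)‖ₑ = ‖ρ (x - y)‖ₑ ^ (1 / 2 : ℝ) * ‖ρ (x - y)‖ₑ ^ (1 / 2 : ℝ) :=
      fun y => by
        rw [← ENNReal.rpow_add_of_nonneg _ _ (by norm_num) (by norm_num)]
        norm_num
    have hol := ENNReal.lintegral_mul_le_Lp_mul_Lq (volume : Measure (RSpace n))
      Real.HolderConjugate.two_two (f := fun y => ‖ρ (x - y)‖ₑ ^ (1 / 2 : ℝ))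
      (g := fun y => ‖ρ (x - y)‖ₑ ^ (1 / 2 : ℝ) * A y)
      (mx.pow_const _).aemeasurable ((mx.pow_const _).aemeasurable.mul hA)
    have e1 : ∀ y, (‖ρ (x - y)‖ₑ ^ (1 / 2 : ℝ)) ^ (2 : ℝ) = ‖ρ (x - y)‖ₑ := fun y => by
      rw [← ENNReal.rpow_mul]
      norm_num
    simp only [Pi.mul_apply, ← mul_assoc, ← hr, ENNReal.mul_rpow_of_nonneg _ _ zero_le_two, e1,
      one, ENNReal.one_rpow, one_mul] at hol
    calc _ ≤ ((∫⁻ y, ‖ρ (x - y)‖ₑ * A y ^ (2 : ℝ)) ^ (1 / 2 : ℝ)) ^ (2 : ℝ) :=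
          ENNReal.rpow_le_rpow hol zero_le_two
      _ = _ := by
        rw [← ENNReal.rpow_mul]
        norm_num
  have swap : ∫⁻ x, ∫⁻ y, ‖ρ (x - y)‖ₑ * A y ^ (2 : ℝ) = ∫⁻ y, A y ^ (2 : ℝ) := by
    rw [lintegral_lintegral_swap]
    · refine lintegral_congr fun y => ?_
      have my : Measurable fun x => ‖ρ (x - y)‖ₑ := mρ.comp (measurable_id.sub measurable_const)
      rw [lintegral_mul_const _ my,
        lintegral_sub_right_eq_self (fun x => ‖ρ x‖ₑ) y, h.lintegral_eq_one, one_mul]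
    · exact (mρ.comp (measurable_fst.sub measurable_snd)).aemeasurable.mul
        ((hA.pow_const _).comp_quasiMeasurePreserving Measure.quasiMeasurePreserving_snd)
  have key : ∫⁻ x, ‖g x‖ₑ ^ (2 : ℝ) ≤ c ^ (2 : ℝ) * ∫⁻ y, A y ^ (2 : ℝ) := by
    calc ∫⁻ x, ‖g x‖ₑ ^ (2 : ℝ)
        ≤ ∫⁻ x, c ^ (2 : ℝ) * ∫⁻ y, ‖ρ (x - y)‖ₑ * A y ^ (2 : ℝ) := by
          refine lintegral_mono fun x => ?_
          refine (ENNReal.rpow_le_rpow (hg x) zero_le_two).trans ?_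
          rw [ENNReal.mul_rpow_of_nonneg _ _ zero_le_two]
          gcongr
          exact cs x
      _ = _ := by
          rw [lintegral_const_mul' _ _ (ENNReal.rpow_ne_top_of_nonneg zero_le_two hc), swap]
  rw [eLpNorm_eq_lintegral_rpow_enorm_toReal two_ne_zero ENNReal.ofNat_ne_top]
  simp only [ENNReal.toReal_ofNat]
  refine (ENNReal.rpow_le_rpow key (by norm_num)).trans (le_of_eq ?_)
  rw [ENNReal.mul_rpow_of_nonneg _ _ (by norm_num), ← ENNReal.rpow_mul]
  norm_num

theorem tsupport_mollify_subset (h : IsMollifier ρ ε) {g : RSpace n → ℝ} {K : Set (RSpace n)}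
    (hg : ∀ᵐ x ∂(volume : Measure (RSpace n)), x ∉ K → g x = 0) :
    tsupport (mollify ρ g) ⊆ Metric.cthickening ε K := by
  refine closure_minimal (fun x hx => ?_) Metric.isClosed_cthickening
  by_contra hx'
  apply hx
  have : (fun y => ρ (x - y) * g y) =ᵐ[volume] fun _ => 0 := by
    filter_upwards [hg] with y hy
    by_cases hyK : y ∈ K
    · have : ρ (x - y) = 0 := by
        by_contra h0
        refine hx' (Metric.mem_cthickening_of_dist_le x y ε K hyK ?_)
        rw [dist_eq_norm]
        exact h.norm_le _ h0
      simp [this]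
    · simp [hy hyK]
  rw [mollify, integral_congr_ae this]
  simp

end IsMollifier

end Mollification

/-! ### The equation satisfied by the mollified solution. -/

section WeakEquation

variable {n : ℕ} {ρ : RSpace n → ℝ}

theorem partialDeriv_mollify_of_weak_gradient {u : RSpace n → ℝ} {G : RSpace n → RSpace n}
    (hu : IsH1WithGradient u G) (hρ : ContDiff ℝ ∞ ρ) (hc : HasCompactSupport ρ) (j : Fin n) :
    partialDeriv j (mollify ρ u) = mollify ρ (fun x => G x j) := by
  rw [partialDeriv_mollify hρ hc (hu.memLp.locallyIntegrable (by norm_num))]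
  funext x
  have h := hu.weak_gradient _ (isTestFunction_comp_sub hρ hc x) j
  simp only [partialDeriv_comp_sub hρ, mul_neg, integral_neg, neg_inj] at h
  simp only [mollify]
  simp only [mul_comm (partialDeriv j ρ _), h, mul_comm (ρ _)]

theorem IsH1WithGradient.memLp_coord {u : RSpace n → ℝ} {G : RSpace n → RSpace n}
    (hu : IsH1WithGradient u G) (j : Fin n) : MemLp (fun x => G x j) 2 volume :=
  (EuclideanSpace.proj (𝕜 := ℝ) j).comp_memLp' hu.memLp_gradient

/-- The weak equation is tested with `y ↦ ρ(x − y)`; differentiation in `y` costs a sign. The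
product `qu` is mollified as a whole, which is the origin of the commutator. -/
theorem lap_mollify_of_weak_solution {k : ℝ} {q f u : RSpace n → ℝ} {F : Fin n → RSpace n → ℝ}
    {G : RSpace n → RSpace n} (hu : IsH1WithGradient u G) (hF : ∀ j, MemLp (F j) 2 volume)
    (hw : IsWeakSolution k q f F u G) (hρ : ContDiff ℝ ∞ ρ) (hc : HasCompactSupport ρ)
    (x : RSpace n) :
    lap (mollify ρ u) x = mollify ρ f x + (∑ j, partialDeriv j (mollify ρ (F j)) x)
      - k ^ 2 * mollify ρ (fun y => q y * u y) x := by
  have h := hw _ (isTestFunction_comp_sub hρ hc x)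
  simp only [partialDeriv_comp_sub hρ, mul_neg, integral_neg, Finset.sum_neg_distrib] at h
  have e1 : lap (mollify ρ u) x = ∑ j, ∫ y, G y j * partialDeriv j ρ (x - y) := by
    refine Finset.sum_congr rfl fun j _ => ?_
    rw [partialDeriv_mollify_of_weak_gradient hu hρ hc,
      partialDeriv_mollify hρ hc ((hu.memLp_coord j).locallyIntegrable (by norm_num))]
    simp only [mollify, mul_comm (partialDeriv j ρ _)]
  have e2 : ∑ j, partialDeriv j (mollify ρ (F j)) x
      = ∑ j, ∫ y, F j y * partialDeriv j ρ (x - y) := by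
    refine Finset.sum_congr rfl fun j _ => ?_
    rw [partialDeriv_mollify hρ hc ((hF j).locallyIntegrable (by norm_num))]
    simp only [mollify, mul_comm (partialDeriv j ρ _)]
  rw [e1, e2]
  simp only [mollify, mul_comm (ρ _)]
  linarith

end WeakEquation

/-! ### From integrals of squares to norms. -/

section SmoothNorms

open scoped ENNReal

variable {n : ℕ}

theorem eLpNorm_two_eq_ofReal_sqrt {h : RSpace n → ℝ} (ch : Continuous h)
    (hc : HasCompactSupport h) :
    eLpNorm h 2 volume = ENNReal.ofReal (Real.sqrt (∫ x, h x ^ 2)) := by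
  have hm : MemLp h 2 volume := ch.memLp_of_hasCompactSupport hc
  rw [hm.eLpNorm_eq_integral_rpow_norm two_ne_zero ENNReal.ofNat_ne_top]
  simp [Real.sqrt_eq_rpow]

theorem ofReal_mul_eLpNorm_le {h : RSpace n → ℝ} (ch : Continuous h)
    (hc : HasCompactSupport h) {c B : ℝ} (hc0 : 0 ≤ c) (hB : 0 ≤ B)
    (hle : c ^ 2 * (∫ x, h x ^ 2) ≤ B ^ 2) :
    ENNReal.ofReal c * eLpNorm h 2 volume ≤ ENNReal.ofReal B := by
  rw [eLpNorm_two_eq_ofReal_sqrt ch hc, ← ENNReal.ofReal_mul hc0]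
  refine ENNReal.ofReal_le_ofReal (abs_le_of_sq_le_sq' ?_ hB).2
  rwa [mul_pow, Real.sq_sqrt (integral_sq_nonneg h)]

/-- The `ℓ²` norm of nonnegative numbers is at most their `ℓ¹` norm, which turns the sum of squares
into the square of the sum of norms. -/
theorem add_mul_sum_sq_le {a M : ℝ} (ha : 0 ≤ a) (hM : 0 ≤ M) {b : Fin n → ℝ}
    (hb : ∀ j, 0 ≤ b j) : a ^ 2 + M ^ 2 * ∑ j, b j ^ 2 ≤ (a + M * ∑ j, b j) ^ 2 := by
  have h1 : ∑ j, b j ^ 2 ≤ (∑ j, b j) ^ 2 :=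
    Finset.sum_sq_le_sq_sum_of_nonneg fun j _ => hb j
  have h2 : 0 ≤ ∑ j, b j := Finset.sum_nonneg fun j _ => hb j
  have h3 := mul_le_mul_of_nonneg_left h1 (sq_nonneg M)
  have h4 : 0 ≤ a * (M * ∑ j, b j) := by positivity
  nlinarith

/-- The gradient with respect to the standard coordinates. -/
noncomputable def gradVec (u : RSpace n → ℝ) (x : RSpace n) : RSpace n :=
  WithLp.toLp 2 fun j => partialDeriv j u x

theorem norm_gradVec_sq (u : RSpace n → ℝ) (x : RSpace n) : ‖gradVec u x‖ ^ 2 = gradSq u x := by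
  rw [norm_sq_eq_sum]
  rfl

theorem continuous_gradVec {u : RSpace n → ℝ} (hu : ContDiff ℝ ∞ u) :
    Continuous (gradVec u) :=
  (PiLp.continuous_toLp 2 _).comp
    (continuous_pi fun j => (contDiff_partialDeriv hu j).continuous)

/-- The right-hand side of the Carleman estimate for smooth functions. -/
noncomputable def smoothCarlemanBound (τ k : ℝ) (q u : RSpace n → ℝ)
    (F : Fin n → RSpace n → ℝ) : ℝ≥0∞ :=
  eLpNorm (fun x => ‖x‖ ^ 2 * (Real.exp (carlemanWeight τ x)
      * (lap u x + k ^ 2 * (q x * u x) - ∑ j, partialDeriv j (F j) x))) 2 volume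
    + ENNReal.ofReal (max τ k)
      * ∑ j, eLpNorm (fun x => Real.exp (carlemanWeight τ x) * F j x) 2 volume

theorem carleman_smooth_eLpNorm (n : ℕ) {κ : ℝ} (hκ : 1 < κ) :
    ∃ C : ℝ, 0 < C ∧ ∀ (τ k : ℝ), 1 ≤ τ → 1 ≤ k → ∀ q : RSpace n → ℝ,
      IsAdmissibleCoefficient κ q → ∀ (u : RSpace n → ℝ) (F : Fin n → RSpace n → ℝ),
      ContDiff ℝ ∞ u → tsupport u ⊆ annulus n →
      (∀ j, ContDiff ℝ ∞ (F j)) → (∀ j, tsupport (F j) ⊆ annulus n) →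
      ENNReal.ofReal τ * eLpNorm (fun x => Real.exp (carlemanWeight τ x) * u x) 2 volume
        ≤ ENNReal.ofReal C * smoothCarlemanBound τ k q u F
      ∧ eLpNorm (fun x => (Real.exp (carlemanWeight τ x) * ‖x‖) • gradVec u x) 2 volume
        ≤ ENNReal.ofReal C * smoothCarlemanBound τ k q u F
      ∧ ENNReal.ofReal (Real.sqrt τ * k) * eLpNorm (fun x =>
          Real.sqrt (q x) * ‖x‖ * Real.exp (carlemanWeight τ x) * u x) 2 volume
        ≤ ENNReal.ofReal C * smoothCarlemanBound τ k q u F := by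
  obtain ⟨C, hC, hmain⟩ := carleman_smooth_divergence n hκ
  refine ⟨Real.sqrt C, Real.sqrt_pos.2 hC, ?_⟩
  intro τ k hτ hk q hq u F hu hus hF hFs
  have hD := hmain τ k hτ hk q hq u F hu hus hF hFs
  have hτ0 : 0 ≤ τ := by linarith
  have hk0 : 0 ≤ k := by linarith
  have hM0 : 0 ≤ max τ k := hτ0.trans (le_max_left _ _)
  have hq0 : ∀ x, 0 ≤ q x := fun x => (by positivity : (0 : ℝ) ≤ κ⁻¹).trans (hq.lower x)
  have cq := hq.contDiff.continuous
  have huc := hasCompactSupport_of_tsupport_subset_annulus hus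
  have cv : ContDiff ℝ ∞ (fun x => Real.exp (carlemanWeight τ x) * u x) :=
    contDiff_exp_carlemanWeight_mul τ hu hus
  have cp : ∀ j, ContDiff ℝ ∞ (fun x => Real.exp (carlemanWeight τ x) * partialDeriv j u x) :=
    fun j => contDiff_exp_carlemanWeight_mul τ (contDiff_partialDeriv hu j)
      ((tsupport_partialDeriv_subset j).trans hus)
  have cH : ∀ j, ContDiff ℝ ∞ (fun x => Real.exp (carlemanWeight τ x) * F j x) :=
    fun j => contDiff_exp_carlemanWeight_mul τ (hF j) (hFs j)
  have hHc : ∀ j, HasCompactSupport (fun x => Real.exp (carlemanWeight τ x) * F j x) :=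
    fun j => (hasCompactSupport_of_tsupport_subset_annulus (hFs j)).mul_left
  have hg : Continuous (fun x => ‖x‖ ^ 2 * (Real.exp (carlemanWeight τ x)
        * (lap u x + k ^ 2 * (q x * u x) - ∑ j, partialDeriv j (F j) x)))
      ∧ HasCompactSupport (fun x => ‖x‖ ^ 2 * (Real.exp (carlemanWeight τ x)
        * (lap u x + k ^ 2 * (q x * u x) - ∑ j, partialDeriv j (F j) x))) := by
    constructor
    · have h1 := continuous_conjugatedOperator (τ := τ) (k := k) cq cv
      have h2 : ∀ j, Continuous
          (fun x => Real.exp (carlemanWeight τ x) * partialDeriv j (F j) x) := fun j =>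
        (contDiff_exp_carlemanWeight_mul τ (contDiff_partialDeriv (hF j) j)
          ((tsupport_partialDeriv_subset j).trans (hFs j))).continuous
      -- The weight alone need not be continuous at the origin, as `log 0 = 0` gives it the value 1
      -- there. Continuity is read from expressions in which it multiplies a function supported in
      -- the annulus.
      have e : (fun x => ‖x‖ ^ 2 * (Real.exp (carlemanWeight τ x)
          * (lap u x + k ^ 2 * (q x * u x) - ∑ j, partialDeriv j (F j) x)))
          = fun x => conjugatedOperator τ k q
              (fun y => Real.exp (carlemanWeight τ y) * u y) x
            - ‖x‖ ^ 2 * ∑ j, Real.exp (carlemanWeight τ x) * partialDeriv j (F j) x := by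
        funext x
        rw [conjugatedOperator_exp_carlemanWeight_mul τ k q hu hus, ← Finset.mul_sum]
        ring
      rw [e]
      fun_prop
    · refine HasCompactSupport.mul_left (HasCompactSupport.mul_left ?_)
      exact (huc.lap.add huc.mul_left.mul_left).sub (hasCompactSupport_finset_sum _ fun j =>
        (hasCompactSupport_of_tsupport_subset_annulus (hFs j)).partialDeriv j)
  set g : RSpace n → ℝ := fun x => ‖x‖ ^ 2 * (Real.exp (carlemanWeight τ x)
        * (lap u x + k ^ 2 * (q x * u x) - ∑ j, partialDeriv j (F j) x)) with hgdef
  set a := Real.sqrt (∫ x, g x ^ 2) with ha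
  let b : Fin n → ℝ := fun j =>
    Real.sqrt (∫ x, (Real.exp (carlemanWeight τ x) * F j x) ^ 2)
  have ha0 : 0 ≤ a := Real.sqrt_nonneg _
  have hb0 : ∀ j, 0 ≤ b j := fun j => Real.sqrt_nonneg _
  have hbs : 0 ≤ ∑ j, b j := Finset.sum_nonneg fun j _ => hb0 j
  set R := Real.sqrt C * (a + max τ k * ∑ j, b j) with hR
  have hR0 : 0 ≤ R := by positivity
  have hRe : ENNReal.ofReal (Real.sqrt C) * smoothCarlemanBound τ k q u F
      = ENNReal.ofReal R := by
    rw [smoothCarlemanBound, eLpNorm_two_eq_ofReal_sqrt hg.1 hg.2]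
    simp only [eLpNorm_two_eq_ofReal_sqrt (cH _).continuous (hHc _)]
    rw [← ENNReal.ofReal_sum_of_nonneg (fun j _ => hb0 j), ← ENNReal.ofReal_mul hM0,
      ← ENNReal.ofReal_add ha0 (by positivity), ← ENNReal.ofReal_mul (Real.sqrt_nonneg _)]
  rw [hRe]
  have i1 : Integrable (fun x => (Real.exp (carlemanWeight τ x) * u x) ^ 2) :=
    integrable_sq_of_hasCompactSupport cv.continuous huc.mul_left
  have i2 : Integrable (fun x => ‖x‖ ^ 2 *
      (∑ j, (Real.exp (carlemanWeight τ x) * partialDeriv j u x) ^ 2)) := by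
    have := fun j => (cp j).continuous
    refine Continuous.integrable_of_hasCompactSupport (by fun_prop) ?_
    exact (hasCompactSupport_finset_sum _ fun j => (huc.partialDeriv j).mul_left.sq).mul_left
  have i3 : Integrable
      (fun x => ‖x‖ ^ 2 * q x * (Real.exp (carlemanWeight τ x) * u x) ^ 2) := by
    have := cv.continuous
    refine Continuous.integrable_of_hasCompactSupport (by fun_prop) ?_
    exact huc.mul_left.sq.mul_left
  have p1 : 0 ≤ ∫ x, (Real.exp (carlemanWeight τ x) * u x) ^ 2 := integral_sq_nonneg _
  have p2 : 0 ≤ ∫ x, ‖x‖ ^ 2 *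
      (∑ j, (Real.exp (carlemanWeight τ x) * partialDeriv j u x) ^ 2) :=
    integral_nonneg fun x => by positivity
  have p3 : 0 ≤ ∫ x, ‖x‖ ^ 2 * q x * (Real.exp (carlemanWeight τ x) * u x) ^ 2 :=
    integral_nonneg fun x => by
      have := hq0 x
      positivity
  rw [integral_add ((i1.const_mul _).fun_add i2) (i3.const_mul _),
    integral_add (i1.const_mul _) i2, integral_const_mul, integral_const_mul] at hD
  have hR2 : C * ((∫ x, g x ^ 2)
      + max τ k ^ 2 * ∑ j, ∫ x, (Real.exp (carlemanWeight τ x) * F j x) ^ 2) ≤ R ^ 2 := by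
    have h1 := add_mul_sum_sq_le ha0 hM0 hb0
    have h2 : ∀ j, b j ^ 2 = ∫ x, (Real.exp (carlemanWeight τ x) * F j x) ^ 2 := fun j =>
      Real.sq_sqrt (integral_sq_nonneg _)
    have h3 : a ^ 2 = ∫ x, g x ^ 2 := Real.sq_sqrt (integral_sq_nonneg _)
    simp only [h2, h3] at h1
    rw [hR, mul_pow, Real.sq_sqrt hC.le]
    exact mul_le_mul_of_nonneg_left h1 hC.le
  have hDR := hD.trans hR2
  have q1 := mul_nonneg (sq_nonneg τ) p1
  have q3 := mul_nonneg (mul_nonneg hτ0 (sq_nonneg k)) p3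
  refine ⟨?_, ?_, ?_⟩
  · exact ofReal_mul_eLpNorm_le cv.continuous huc.mul_left hτ0 hR0 (by linarith)
  · have e : ∀ x, ‖(Real.exp (carlemanWeight τ x) * ‖x‖) • gradVec u x‖ ^ 2
        = ‖x‖ ^ 2 * (∑ j, (Real.exp (carlemanWeight τ x) * partialDeriv j u x) ^ 2) := by
      intro x
      rw [norm_smul, mul_pow, norm_gradVec_sq, gradSq]
      simp only [mul_pow, ← Finset.mul_sum, norm_mul, Real.norm_eq_abs, sq_abs]
      ring
    rw [← eLpNorm_norm, ← one_mul (eLpNorm _ _ _), ← ENNReal.ofReal_one]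
    have cG : Continuous (fun x => (Real.exp (carlemanWeight τ x) * ‖x‖) • gradVec u x) := by
      have e' : (fun x => (Real.exp (carlemanWeight τ x) * ‖x‖) • gradVec u x)
          = fun x => ‖x‖ • WithLp.toLp 2
            (fun j => Real.exp (carlemanWeight τ x) * partialDeriv j u x) := by
        funext x
        ext j
        simp [gradVec]
        ring
      rw [e']
      exact continuous_norm.smul ((PiLp.continuous_toLp 2 _).comp
        (continuous_pi fun j => (cp j).continuous))
    have hGc : HasCompactSupport (fun x => ‖(Real.exp (carlemanWeight τ x) * ‖x‖)
        • gradVec u x‖) := by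
      refine hasCompactSupport_of_norm_le (r := 2) fun x hx => ?_
      by_contra! h
      have h0 : x ∉ tsupport u := fun h' => by linarith [(hus h').2]
      apply hx
      have : gradVec u x = 0 := by
        ext j
        exact partialDeriv_eq_zero_of_notMem_tsupport h0 j
      simp [this]
    refine ofReal_mul_eLpNorm_le cG.norm hGc zero_le_one hR0 ?_
    simp only [e]
    linarith
  · have e : ∀ x, (Real.sqrt (q x) * ‖x‖ * Real.exp (carlemanWeight τ x) * u x) ^ 2
        = ‖x‖ ^ 2 * q x * (Real.exp (carlemanWeight τ x) * u x) ^ 2 := by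
      intro x
      simp only [mul_pow, Real.sq_sqrt (hq0 x)]
      ring
    have e' : (fun x => Real.sqrt (q x) * ‖x‖ * Real.exp (carlemanWeight τ x) * u x)
        = fun x => Real.sqrt (q x) * ‖x‖ * (Real.exp (carlemanWeight τ x) * u x) := by
      funext x
      ring
    have cK : Continuous
        (fun x => Real.sqrt (q x) * ‖x‖ * Real.exp (carlemanWeight τ x) * u x) := by
      rw [e']
      have := cv.continuous
      fun_prop
    refine ofReal_mul_eLpNorm_le cK huc.mul_left (by positivity) hR0 ?_
    simp only [e]
    rw [mul_pow, Real.sq_sqrt hτ0]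
    linarith

end SmoothNorms

/-! ### Stability of the weighted norms and the commutator under mollification. -/

section Approximation

open scoped ENNReal

variable {n : ℕ}

/-- Since `|y| > 1`, `|x| ≤ |y| + ε ≤ (1+ε)|y| ≤ e^ε|y|`, so `φ` grows by at most `τε`. The bound `ε
≤ 1/2` keeps `x` away from the origin. -/
theorem exp_carlemanWeight_le_mul {τ ε : ℝ} (hτ : 0 ≤ τ) (hε : ε ≤ 1 / 2) {x y : RSpace n}
    (hxy : ‖x - y‖ ≤ ε) (hy : 1 < ‖y‖) :
    0 < ‖x‖ ∧ ‖x‖ ≤ Real.exp ε * ‖y‖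
      ∧ Real.exp (carlemanWeight τ x) ≤ Real.exp (τ * ε) * Real.exp (carlemanWeight τ y) := by
  have hε0 : 0 ≤ ε := (norm_nonneg _).trans hxy
  have h1 : ‖x‖ ≤ ‖y‖ + ε := by
    have := norm_add_le (x - y) y
    rw [sub_add_cancel] at this
    linarith
  have h2 : ‖y‖ - ε ≤ ‖x‖ := by
    have := norm_sub_norm_le y x
    rw [norm_sub_rev] at this
    linarith
  have h3 : 0 < ‖x‖ := by linarith
  have h4 : ‖x‖ ≤ Real.exp ε * ‖y‖ := by
    have h5 : (ε + 1) * ‖y‖ ≤ Real.exp ε * ‖y‖ :=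
      mul_le_mul_of_nonneg_right (Real.add_one_le_exp ε) (norm_nonneg _)
    nlinarith
  refine ⟨h3, h4, ?_⟩
  rw [← Real.exp_add]
  refine Real.exp_le_exp.2 ?_
  have h5 : Real.log ‖x‖ ≤ ε + Real.log ‖y‖ := by
    have := Real.log_le_log h3 h4
    rwa [Real.log_mul (Real.exp_pos _).ne' (by linarith), Real.log_exp] at this
  have := mul_le_mul_of_nonneg_left h5 hτ
  simp only [carlemanWeight]
  linarith

/-- The condition `(τ+2)ε ≤ log 2` bounds `e^{τε}·e^{2ε}` by 2, so the loss does not depend on `τ`.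
-/
theorem exp_carlemanWeight_comparison {τ ε : ℝ} (hτ : 0 ≤ τ) (hε : ε ≤ 1 / 2)
    (hε' : (τ + 2) * ε ≤ Real.log 2) {x y : RSpace n} (hxy : ‖x - y‖ ≤ ε)
    (hy : y ∈ annulus n) :
    Real.exp (carlemanWeight τ x) ≤ 2 * Real.exp (carlemanWeight τ y)
      ∧ Real.exp (carlemanWeight τ x) * ‖x‖ ^ 2
        ≤ 2 * (Real.exp (carlemanWeight τ y) * ‖y‖ ^ 2) := by
  obtain ⟨-, h2, h3⟩ := exp_carlemanWeight_le_mul hτ hε hxy hy.1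
  have hε0 : 0 ≤ ε := (norm_nonneg _).trans hxy
  have e1 : Real.exp (τ * ε) ≤ 2 := by
    rw [← Real.exp_log (zero_lt_two' ℝ)]
    exact Real.exp_le_exp.2 (by linarith)
  have e2 : Real.exp (τ * ε) * Real.exp ε ^ 2 ≤ 2 := by
    rw [← Real.exp_log (zero_lt_two' ℝ), ← Real.exp_nat_mul, ← Real.exp_add]
    refine Real.exp_le_exp.2 ?_
    push_cast
    linarith
  have hy0 := Real.exp_pos (carlemanWeight τ y)
  constructor
  · exact h3.trans (mul_le_mul_of_nonneg_right e1 hy0.le)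
  · have h4 : ‖x‖ ^ 2 ≤ (Real.exp ε * ‖y‖) ^ 2 := pow_le_pow_left₀ (norm_nonneg _) h2 2
    calc _ ≤ (Real.exp (τ * ε) * Real.exp (carlemanWeight τ y)) * (Real.exp ε * ‖y‖) ^ 2 :=
          mul_le_mul h3 h4 (by positivity) (by positivity)
      _ = (Real.exp (τ * ε) * Real.exp ε ^ 2)
          * (Real.exp (carlemanWeight τ y) * ‖y‖ ^ 2) := by ring
      _ ≤ _ := mul_le_mul_of_nonneg_right e2 (by positivity)

theorem lintegral_rpow_enorm_eq_eLpNorm (g : RSpace n → ℝ) :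
    (∫⁻ y, ‖g y‖ₑ ^ (2 : ℝ)) ^ (1 / 2 : ℝ) = eLpNorm g 2 volume := by
  rw [eLpNorm_eq_lintegral_rpow_enorm_toReal two_ne_zero ENNReal.ofNat_ne_top]
  simp

/-- The weight moves inside the average at the cost of the factor 2, and Young's inequality applies
to `Wf`. -/
theorem IsMollifier.eLpNorm_weight_mul_mollify_le {ρ : RSpace n → ℝ} {ε : ℝ}
    (h : IsMollifier ρ ε) {W f : RSpace n → ℝ} {K : Set (RSpace n)} (hW : Measurable W)
    (hW0 : ∀ x, 0 ≤ W x) (hWK : ∀ x y, ‖x - y‖ ≤ ε → y ∈ K → W x ≤ 2 * W y)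
    (hf : AEStronglyMeasurable f volume)
    (hfK : ∀ᵐ x ∂(volume : Measure (RSpace n)), x ∉ K → f x = 0) :
    eLpNorm (fun x => W x * mollify ρ f x) 2 volume
      ≤ 2 * eLpNorm (fun x => W x * f x) 2 volume := by
  rw [← lintegral_rpow_enorm_eq_eLpNorm (fun x => W x * f x)]
  refine h.eLpNorm_le_of_enorm_le (hW.aestronglyMeasurable.mul hf).enorm
    ENNReal.ofNat_ne_top fun x => ?_
  rw [enorm_mul]
  calc ‖W x‖ₑ * ‖mollify ρ f x‖ₑ
      ≤ ‖W x‖ₑ * ∫⁻ y, ‖ρ (x - y) * f y‖ₑ := by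
        gcongr
        exact enorm_integral_le_lintegral_enorm _
    _ = ∫⁻ y, ‖W x‖ₑ * ‖ρ (x - y) * f y‖ₑ := by
        rw [lintegral_const_mul' _ _ enorm_ne_top]
    _ ≤ ∫⁻ y, 2 * (‖ρ (x - y)‖ₑ * ‖W y * f y‖ₑ) := by
        refine lintegral_mono_ae ?_
        filter_upwards [hfK] with y hy
        by_cases hyK : y ∈ K
        · by_cases hρ : ρ (x - y) = 0
          · simp [hρ]
          · have h1 := hWK x y (h.norm_le _ hρ) hyK
            have h2 : ‖W x‖ₑ ≤ 2 * ‖W y‖ₑ := by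
              rw [Real.enorm_of_nonneg (hW0 x), Real.enorm_of_nonneg (hW0 y),
                ← ENNReal.ofReal_ofNat, ← ENNReal.ofReal_mul zero_le_two]
              exact ENNReal.ofReal_le_ofReal h1
            rw [enorm_mul, enorm_mul]
            calc _ ≤ (2 * ‖W y‖ₑ) * (‖ρ (x - y)‖ₑ * ‖f y‖ₑ) := by gcongr
              _ = _ := by ring
        · simp [hy hyK]
    _ = _ := lintegral_const_mul' _ _ ENNReal.ofNat_ne_top

/-- The difference is the average of `(q(y) − q(x)) u(y)`, so only the oscillation of `q` at scale
`ε` enters. -/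
theorem IsMollifier.enorm_mollify_mul_sub_le {ρ : RSpace n → ℝ} {ε : ℝ}
    (h : IsMollifier ρ ε) {q u : RSpace n → ℝ} (hu : LocallyIntegrable u volume)
    (hqu : LocallyIntegrable (fun y => q y * u y) volume) {σ : ℝ} {x : RSpace n}
    (hx : ∀ y, ‖x - y‖ ≤ ε → |q y - q x| ≤ σ) :
    ‖mollify ρ (fun y => q y * u y) x - q x * mollify ρ u x‖ₑ
      ≤ ENNReal.ofReal σ * ∫⁻ y, ‖ρ (x - y)‖ₑ * ‖u y‖ₑ := by
  have hc := h.contDiff.continuous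
  have i1 := integrable_mollify_integrand hc h.hasCompactSupport hqu x
  have i2 := (integrable_mollify_integrand hc h.hasCompactSupport hu x).const_mul (q x)
  have e : mollify ρ (fun y => q y * u y) x - q x * mollify ρ u x
      = ∫ y, (ρ (x - y) * (q y * u y) - q x * (ρ (x - y) * u y)) := by
    rw [integral_sub i1 i2, integral_const_mul]
    rfl
  rw [e, ← lintegral_const_mul' _ _ ENNReal.ofReal_ne_top]
  refine (enorm_integral_le_lintegral_enorm _).trans (lintegral_mono fun y => ?_)
  have e2 : ρ (x - y) * (q y * u y) - q x * (ρ (x - y) * u y)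
      = (q y - q x) * (ρ (x - y) * u y) := by ring
  rw [e2, enorm_mul, enorm_mul]
  by_cases hρ : ρ (x - y) = 0
  · simp [hρ]
  · gcongr
    rw [Real.enorm_eq_ofReal_abs]
    exact ENNReal.ofReal_le_ofReal (hx y (h.norm_le _ hρ))

theorem isOpen_annulus : IsOpen (annulus n) :=
  (isOpen_lt continuous_const continuous_norm).inter (isOpen_lt continuous_norm continuous_const)

theorem measurable_exp_carlemanWeight (τ : ℝ) :
    Measurable fun x : RSpace n => Real.exp (carlemanWeight τ x) := by
  unfold carlemanWeight
  fun_prop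

theorem CompactlySupportedIn.exists_tsupport_mollify_subset {u : RSpace n → ℝ}
    {U : Set (RSpace n)} (hu : CompactlySupportedIn u U) (hU : IsOpen U) :
    ∃ δ : ℝ, 0 < δ ∧ ∀ (ρ : RSpace n → ℝ) (ε : ℝ), ε ≤ δ → IsMollifier ρ ε →
      tsupport (mollify ρ u) ⊆ U := by
  obtain ⟨K, hK, hKU, hKu⟩ := hu
  obtain ⟨δ, hδ, hδU⟩ := hK.exists_cthickening_subset_open hU hKU
  exact ⟨δ, hδ, fun ρ ε hε hρ => (hρ.tsupport_mollify_subset hKu).trans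
    ((Metric.cthickening_mono hε K).trans hδU)⟩

theorem CompactlySupportedIn.ae_eq_zero {u : RSpace n → ℝ}
    {U : Set (RSpace n)} (hu : CompactlySupportedIn u U) :
    ∀ᵐ x ∂(volume : Measure (RSpace n)), x ∉ U → u x = 0 := by
  obtain ⟨K, -, hKU, hKu⟩ := hu
  filter_upwards [hKu] with x hx hxU
  exact hx fun h => hxU (hKU h)

theorem CompactlySupportedIn.mul_left {u : RSpace n → ℝ} {U : Set (RSpace n)}
    (hu : CompactlySupportedIn u U) (q : RSpace n → ℝ) :
    CompactlySupportedIn (fun x => q x * u x) U := by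
  obtain ⟨K, hK, hKU, hKu⟩ := hu
  refine ⟨K, hK, hKU, ?_⟩
  filter_upwards [hKu] with x hx hxK
  simp [hx hxK]

theorem IsAdmissibleCoefficient.memLp_mul {κ : ℝ} {q u : RSpace n → ℝ} (hκ : 0 < κ)
    (hq : IsAdmissibleCoefficient κ q) (hu : MemLp u 2 volume) :
    MemLp (fun x => q x * u x) 2 volume := by
  refine hu.of_le_mul (c := κ)
    (hq.contDiff.continuous.aestronglyMeasurable.mul hu.aestronglyMeasurable)
    (Filter.Eventually.of_forall fun x => ?_)
  have h0 : 0 ≤ q x := (inv_pos.2 hκ).le.trans (hq.lower x)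
  rw [norm_mul, Real.norm_of_nonneg h0]
  exact mul_le_mul_of_nonneg_right (hq.upper x) (norm_nonneg _)

theorem exists_uniform_modulus {q : RSpace n → ℝ} (hq : Continuous q) {σ : ℝ} (hσ : 0 < σ) :
    ∃ δ : ℝ, 0 < δ ∧ ∀ x ∈ annulus n, ∀ y, ‖x - y‖ ≤ δ → |q y - q x| ≤ σ := by
  have hK : IsCompact (Metric.closedBall (0 : RSpace n) 3) := isCompact_closedBall _ _
  have hU := hK.uniformContinuousOn_of_continuous hq.continuousOn
  obtain ⟨δ, hδ, h⟩ := Metric.uniformContinuousOn_iff_le.1 hU σ hσ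
  refine ⟨min δ 1, by positivity, fun x hx y hxy => ?_⟩
  have hx2 := hx.2
  have h1 : ‖x - y‖ ≤ 1 := hxy.trans (min_le_right _ _)
  have h2 : ‖y‖ ≤ 3 := by
    have := norm_sub_norm_le y x
    rw [norm_sub_rev] at this
    linarith
  have := h y (by simpa using h2) x (by simp only [Metric.mem_closedBall, dist_zero_right]; linarith)
    (by rw [dist_comm, dist_eq_norm]; exact hxy.trans (min_le_left _ _))
  rwa [Real.dist_eq] at this

/-- The right-hand side of the Carleman estimate. -/
noncomputable def carlemanBound (τ k : ℝ) (f : RSpace n → ℝ) (F : Fin n → RSpace n → ℝ) : ℝ≥0∞ :=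
  eLpNorm (fun x => Real.exp (carlemanWeight τ x) * ‖x‖ ^ 2 * f x) 2 volume
    + ENNReal.ofReal (max τ k) *
      ∑ j, eLpNorm (fun x => Real.exp (carlemanWeight τ x) * ‖x‖ * F j x) 2 volume

theorem eLpNorm_exp_carlemanWeight_mul_le (τ : ℝ) {f : RSpace n → ℝ}
    (hf : CompactlySupportedIn f (annulus n)) :
    eLpNorm (fun x => Real.exp (carlemanWeight τ x) * f x) 2 volume
      ≤ eLpNorm (fun x => Real.exp (carlemanWeight τ x) * ‖x‖ * f x) 2 volume := by
  refine eLpNorm_mono_ae ?_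
  filter_upwards [hf.ae_eq_zero] with x hx
  by_cases h : x ∈ annulus n
  · have h1 := h.1
    have h2 : 0 ≤ ‖Real.exp (carlemanWeight τ x)‖ * ‖f x‖ := by positivity
    rw [norm_mul, norm_mul, norm_mul, norm_norm]
    nlinarith
  · simp [hx h]

/-- Mollified solutions satisfy the equation up to an error that is small in norm. -/
theorem exists_smoothCarlemanBound_mollify_le {κ τ k : ℝ} (hκ : 1 < κ) (hτ : 0 ≤ τ)
    {q f u : RSpace n → ℝ} {F : Fin n → RSpace n → ℝ} {G : RSpace n → RSpace n}
    (hq : IsAdmissibleCoefficient κ q) (hf : MemLp f 2 volume) (hF : ∀ j, MemLp (F j) 2 volume)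
    (hfs : CompactlySupportedIn f (annulus n)) (hFs : ∀ j, CompactlySupportedIn (F j) (annulus n))
    (hu : IsH1WithGradient u G) (hus : CompactlySupportedIn u (annulus n))
    (hw : IsWeakSolution k q f F u G) {θ : ℝ} (hθ : 0 < θ) :
    ∃ δ : ℝ, 0 < δ ∧ ∀ (ρ : RSpace n → ℝ) (ε : ℝ), ε ≤ δ → IsMollifier ρ ε →
      tsupport (mollify ρ u) ⊆ annulus n ∧ (∀ j, tsupport (mollify ρ (F j)) ⊆ annulus n)
      ∧ smoothCarlemanBound τ k q (mollify ρ u) (fun j => mollify ρ (F j))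
        ≤ 2 * carlemanBound τ k f F + ENNReal.ofReal θ := by
  have hqu := hq.memLp_mul (by linarith) hu.memLp
  have cq := hq.contDiff.continuous
  have lu := hu.memLp.locallyIntegrable (by norm_num)
  have lqu := hqu.locallyIntegrable (by norm_num)
  have lf := hf.locallyIntegrable (by norm_num)
  set N := (eLpNorm u 2 volume).toReal with hN
  have hN0 : 0 ≤ N := ENNReal.toReal_nonneg
  -- On the annulus `e^φ|x|²k² ≤ Λ`. The choice of `σ` makes `ΛσN ≤ θ`; the added ones avoid
  -- division by zero.
  set Λ := Real.exp (τ * Real.log 2) * 4 * k ^ 2 with hΛ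
  have hΛ0 : 0 ≤ Λ := by positivity
  set σ := θ / ((Λ + 1) * (N + 1)) with hσdef
  have hσ : 0 < σ := by positivity
  obtain ⟨δ₁, hδ₁, h₁⟩ := hus.exists_tsupport_mollify_subset isOpen_annulus
  -- With `ρ*u` and `ρ*(qu)` both supported in the annulus, the commutator vanishes outside it,
  -- where `Λ` is no bound for the weight.
  obtain ⟨δ₂, hδ₂, h₂⟩ := (hus.mul_left q).exists_tsupport_mollify_subset isOpen_annulus
  obtain ⟨δ₃, hδ₃, h₃⟩ := exists_uniform_modulus (n := n) cq hσ
  choose δ₄ hδ₄ h₄ using fun j => (hFs j).exists_tsupport_mollify_subset isOpen_annulus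
  obtain ⟨δ₅, hδ₅, h₅⟩ : ∃ δ : ℝ, 0 < δ ∧ ∀ j, δ ≤ δ₄ j := by
    rcases isEmpty_or_nonempty (Fin n) with hn | hn
    · exact ⟨1, one_pos, fun j => hn.elim j⟩
    · obtain ⟨i, hi⟩ := Finite.exists_min δ₄
      exact ⟨δ₄ i, hδ₄ i, hi⟩
  refine ⟨min (min (min δ₁ δ₂) (min δ₃ δ₅)) (min (1 / 2) (Real.log 2 / (τ + 2))),
    by have := Real.log_pos one_lt_two; positivity, ?_⟩
  intro ρ ε hε hρ
  obtain ⟨⟨⟨e₁, e₂⟩, e₃, e₅⟩, e₆, e₇⟩ : ((ε ≤ δ₁ ∧ ε ≤ δ₂) ∧ ε ≤ δ₃ ∧ ε ≤ δ₅)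
      ∧ ε ≤ 1 / 2 ∧ ε ≤ Real.log 2 / (τ + 2) := by
    simpa only [le_min_iff] using hε
  have e₈ : (τ + 2) * ε ≤ Real.log 2 := by
    rw [le_div_iff₀ (by linarith)] at e₇
    linarith
  have su := h₁ ρ ε e₁ hρ
  have squ := h₂ ρ ε e₂ hρ
  refine ⟨su, fun j => h₄ j ρ ε (e₅.trans (h₅ j)) hρ, ?_⟩
  have hc := hρ.hasCompactSupport
  have mE := measurable_exp_carlemanWeight (n := n) τ
  have mW : Measurable fun x : RSpace n => Real.exp (carlemanWeight τ x) * ‖x‖ ^ 2 :=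
    mE.mul (measurable_norm.pow_const 2)
  have cmp := fun x y hxy hy =>
    exp_carlemanWeight_comparison (n := n) (x := x) (y := y) hτ e₆ e₈ hxy hy
  have eq : ∀ x, ‖x‖ ^ 2 * (Real.exp (carlemanWeight τ x) * (lap (mollify ρ u) x
      + k ^ 2 * (q x * mollify ρ u x) - ∑ j, partialDeriv j (mollify ρ (F j)) x))
      = Real.exp (carlemanWeight τ x) * ‖x‖ ^ 2 * mollify ρ f x
        - Real.exp (carlemanWeight τ x) * ‖x‖ ^ 2 * k ^ 2
          * (mollify ρ (fun y => q y * u y) x - q x * mollify ρ u x) := by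
    intro x
    rw [lap_mollify_of_weak_solution hu hF hw hρ.contDiff hc]
    ring
  have cm : ∀ {g : RSpace n → ℝ}, LocallyIntegrable g volume → Continuous (mollify ρ g) :=
    fun hg => (contDiff_mollify hρ.contDiff hc hg).continuous
  have hcomm : eLpNorm (fun x => Real.exp (carlemanWeight τ x) * ‖x‖ ^ 2 * k ^ 2
      * (mollify ρ (fun y => q y * u y) x - q x * mollify ρ u x)) 2 volume
      ≤ ENNReal.ofReal θ := by
    have h1 := hρ.eLpNorm_le_of_enorm_le (A := fun y => ‖u y‖ₑ)
      hu.memLp.aestronglyMeasurable.enorm (c := ENNReal.ofReal (Λ * σ)) ENNReal.ofReal_ne_top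
      (g := fun x => Real.exp (carlemanWeight τ x) * ‖x‖ ^ 2 * k ^ 2
        * (mollify ρ (fun y => q y * u y) x - q x * mollify ρ u x)) (fun x => by
        by_cases hx : x ∈ annulus n
        · have h2 := hρ.enorm_mollify_mul_sub_le lu lqu
            (fun y hy => h₃ x hx y (hy.trans e₃))
          rw [enorm_mul, ENNReal.ofReal_mul hΛ0, mul_assoc (ENNReal.ofReal Λ)]
          refine mul_le_mul' ?_ h2
          rw [Real.enorm_of_nonneg (by positivity)]
          refine ENNReal.ofReal_le_ofReal ?_
          have h3 : Real.exp (carlemanWeight τ x) ≤ Real.exp (τ * Real.log 2) :=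
            Real.exp_le_exp.2 (mul_le_mul_of_nonneg_left
              (Real.log_le_log (by linarith [hx.1]) hx.2.le) hτ)
          have h4 : ‖x‖ ^ 2 ≤ 4 := by nlinarith [hx.1, hx.2]
          exact mul_le_mul_of_nonneg_right (mul_le_mul h3 h4 (by positivity) (by positivity))
            (by positivity)
        · have z1 : mollify ρ u x = 0 :=
            image_eq_zero_of_notMem_tsupport fun h => hx (su h)
          have z2 : mollify ρ (fun y => q y * u y) x = 0 :=
            image_eq_zero_of_notMem_tsupport fun h => hx (squ h)
          simp [z1, z2])
    rw [lintegral_rpow_enorm_eq_eLpNorm] at h1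
    refine h1.trans ?_
    rw [← ENNReal.ofReal_toReal hu.memLp.eLpNorm_ne_top, ← hN,
      ← ENNReal.ofReal_mul (by positivity)]
    refine ENNReal.ofReal_le_ofReal ?_
    have : σ * ((Λ + 1) * (N + 1)) = θ := div_mul_cancel₀ _ (by positivity)
    nlinarith [mul_nonneg hσ.le hΛ0, mul_nonneg hσ.le hN0, mul_nonneg (mul_nonneg hσ.le hΛ0) hN0]
  have hfirst : eLpNorm (fun x => ‖x‖ ^ 2 * (Real.exp (carlemanWeight τ x)
      * (lap (mollify ρ u) x + k ^ 2 * (q x * mollify ρ u x)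
        - ∑ j, partialDeriv j (mollify ρ (F j)) x))) 2 volume
      ≤ 2 * eLpNorm (fun x => Real.exp (carlemanWeight τ x) * ‖x‖ ^ 2 * f x) 2 volume
        + ENNReal.ofReal θ := by
    simp only [eq]
    refine (eLpNorm_sub_le (mW.mul (cm lf).measurable).aestronglyMeasurable
      ((mW.mul_const _).mul ((cm lqu).sub (cq.mul (cm lu))).measurable).aestronglyMeasurable
      (by norm_num)).trans (add_le_add ?_ hcomm)
    exact hρ.eLpNorm_weight_mul_mollify_le (K := annulus n) mW (fun x => by positivity)
      (fun x y hxy hy => (cmp x y hxy hy).2) hf.aestronglyMeasurable hfs.ae_eq_zero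
  have hsecond : ∀ j, eLpNorm (fun x => Real.exp (carlemanWeight τ x) * mollify ρ (F j) x) 2
      volume ≤ 2 * eLpNorm (fun x => Real.exp (carlemanWeight τ x) * ‖x‖ * F j x) 2 volume := by
    intro j
    refine (hρ.eLpNorm_weight_mul_mollify_le (K := annulus n) mE (fun x => by positivity)
      (fun x y hxy hy => (cmp x y hxy hy).1) (hF j).aestronglyMeasurable
      (hFs j).ae_eq_zero).trans ?_
    gcongr
    exact eLpNorm_exp_carlemanWeight_mul_le τ (hFs j)
  unfold smoothCarlemanBound carlemanBound
  calc _ ≤ (2 * eLpNorm (fun x => Real.exp (carlemanWeight τ x) * ‖x‖ ^ 2 * f x) 2 volume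
        + ENNReal.ofReal θ) + ENNReal.ofReal (max τ k) * ∑ j, 2 *
          eLpNorm (fun x => Real.exp (carlemanWeight τ x) * ‖x‖ * F j x) 2 volume := by
        gcongr with j
        exact hsecond j
    _ = _ := by
        rw [← Finset.mul_sum]
        ring

end Approximation

/-! ### Passage to the limit and the main theorem. -/

section Limit

open Filter
open scoped ENNReal Topology

variable {n : ℕ}

theorem ofReal_mul_eLpNorm {c : ℝ} (hc : 0 ≤ c) (h : RSpace n → ℝ) :
    ENNReal.ofReal c * eLpNorm h 2 volume = eLpNorm (fun x => c * h x) 2 volume := by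
  have := eLpNorm_const_smul c h 2 (volume : Measure (RSpace n))
  rw [Real.enorm_of_nonneg hc] at this
  exact this.symm

theorem exists_mollifier_sequence (n : ℕ) :
    ∃ (ρ : ℕ → RSpace n → ℝ) (ε : ℕ → ℝ), (∀ i, IsMollifier (ρ i) (ε i))
      ∧ Tendsto ε atTop (𝓝 0)
      ∧ ∀ g : RSpace n → ℝ, LocallyIntegrable g volume →
        ∀ᵐ x ∂(volume : Measure (RSpace n)), Tendsto (fun i => mollify (ρ i) g x) atTop (𝓝 (g x)) := by
  -- The ratio 2 of outer to inner radius is fixed, which keeps the kernels comparable to averages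
  -- over balls and yields convergence almost everywhere.
  let φ : ℕ → ContDiffBump (0 : RSpace n) := fun i =>
    ⟨1 / ((i : ℝ) + 1), 2 * (1 / ((i : ℝ) + 1)), by positivity, by
      have : 0 < 1 / ((i : ℝ) + 1) := by positivity
      linarith⟩
  have hφ : Tendsto (fun i => (φ i).rOut) atTop (𝓝 0) := by
    have := (tendsto_one_div_add_atTop_nhds_zero_nat (𝕜 := ℝ)).const_mul 2
    rwa [mul_zero] at this
  refine ⟨fun i => (φ i).normed volume, fun i => (φ i).rOut, fun i => (φ i).isMollifier, hφ,
    fun g hg => ?_⟩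
  have := ContDiffBump.ae_convolution_tendsto_right_of_locallyIntegrable (K := 2) hφ
    (Eventually.of_forall fun i => le_rfl) hg
  simpa only [mollify_eq_convolution] using this

/-- Norms are `eLpNorm · 2 volume`, with values in `[0, ∞]`; the hypotheses make the right-hand side
finite, so the inequality contains the finiteness of every norm on the left. -/
theorem proposition3 (n : ℕ) (hn : 2 ≤ n) (κ : ℝ) (hκ : 1 < κ) :
    ∃ τ₀ : ℝ, 0 < τ₀ ∧ ∃ C : ℝ, 0 < C ∧
      ∀ (τ : ℝ), τ₀ ≤ τ →
      ∀ (k : ℝ), 1 ≤ k →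
      ∀ (q : RSpace n → ℝ), IsAdmissibleCoefficient κ q →
      ∀ (f : RSpace n → ℝ) (F : Fin n → RSpace n → ℝ),
        MemLp f 2 volume → (∀ j, MemLp (F j) 2 volume) →
        CompactlySupportedIn f (annulus n) → (∀ j, CompactlySupportedIn (F j) (annulus n)) →
      ∀ (u : RSpace n → ℝ) (G : RSpace n → RSpace n),
        IsH1WithGradient u G → CompactlySupportedIn u (annulus n) →
        IsWeakSolution k q f F u G →
        ENNReal.ofReal τ *
            eLpNorm (fun x => Real.exp (carlemanWeight τ x) * u x) 2 volume
          + eLpNorm (fun x => (Real.exp (carlemanWeight τ x) * ‖x‖) • G x) 2 volume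
          + ENNReal.ofReal (Real.sqrt τ * k) *
            eLpNorm (fun x => Real.sqrt (q x) * ‖x‖ * Real.exp (carlemanWeight τ x) * u x) 2 volume
        ≤ ENNReal.ofReal C *
          (eLpNorm (fun x => Real.exp (carlemanWeight τ x) * ‖x‖ ^ 2 * f x) 2 volume
            + ENNReal.ofReal (max τ k) *
              ∑ j, eLpNorm (fun x => Real.exp (carlemanWeight τ x) * ‖x‖ * F j x) 2 volume) := by
  obtain ⟨C, hC, hsmooth⟩ := carleman_smooth_eLpNorm n hκ
  -- The factor 6 is 3, for the separately bounded terms on the left, times 2, for the mollification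
  -- of the weighted source norms.
  refine ⟨1, one_pos, 6 * C, by positivity, ?_⟩
  intro τ hτ k hk q hq f F hf hF hfs hFs u G hu hus hw
  have hτ0 : 0 ≤ τ := by linarith
  have cq := hq.contDiff.continuous
  have lu := hu.memLp.locallyIntegrable (by norm_num)
  have lG := fun j => (hu.memLp_coord j).locallyIntegrable (by norm_num)
  have lF := fun j => (hF j).locallyIntegrable (by norm_num)
  have mE := measurable_exp_carlemanWeight (n := n) τ
  change _ ≤ ENNReal.ofReal (6 * C) * carlemanBound τ k f F
  obtain ⟨ρ, ε, hρ, hε, hlim⟩ := exists_mollifier_sequence n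
  have cm : ∀ i {g : RSpace n → ℝ}, LocallyIntegrable g volume →
      ContDiff ℝ ∞ (mollify (ρ i) g) := fun i _ hg =>
    contDiff_mollify (hρ i).contDiff (hρ i).hasCompactSupport hg
  have hgrad : ∀ i, gradVec (mollify (ρ i) u)
      = fun x => WithLp.toLp 2 fun j => mollify (ρ i) (fun y => G y j) x := by
    intro i
    funext x
    unfold gradVec
    simp only [partialDeriv_mollify_of_weak_gradient hu (hρ i).contDiff (hρ i).hasCompactSupport]
  have hlimG : ∀ᵐ x ∂(volume : Measure (RSpace n)),
      Tendsto (fun i => gradVec (mollify (ρ i) u) x) atTop (𝓝 (G x)) := by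
    have := ae_all_iff.2 fun j => hlim _ (lG j)
    filter_upwards [this] with x hx
    simp only [hgrad]
    exact ((PiLp.continuous_toLp 2 (fun _ : Fin n => ℝ)).tendsto (fun j => G x j)).comp
      (tendsto_pi_nhds.2 hx)
  have hlimu := hlim u lu
  -- For fixed `θ`, each term passes to the limit by Fatou's lemma from almost everywhere
  -- convergence and the eventual uniform bound; no convergence in norm is needed.
  have main : ∀ θ : ℝ, 0 < θ →
      ENNReal.ofReal τ * eLpNorm (fun x => Real.exp (carlemanWeight τ x) * u x) 2 volume
          + eLpNorm (fun x => (Real.exp (carlemanWeight τ x) * ‖x‖) • G x) 2 volume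
          + ENNReal.ofReal (Real.sqrt τ * k) *
            eLpNorm (fun x => Real.sqrt (q x) * ‖x‖ * Real.exp (carlemanWeight τ x) * u x) 2 volume
        ≤ 3 * (ENNReal.ofReal C * (2 * carlemanBound τ k f F + ENNReal.ofReal θ)) := by
    intro θ hθ
    obtain ⟨δ, hδ, happ⟩ :=
      exists_smoothCarlemanBound_mollify_le hκ hτ0 hq hf hF hfs hFs hu hus hw hθ
    have hev : ∀ᶠ i in atTop, ε i ≤ δ := (hε.eventually (gt_mem_nhds hδ)).mono fun i hi => hi.le
    have hbound := hev.mono fun i hi => by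
      obtain ⟨s1, s2, s3⟩ := happ (ρ i) (ε i) hi (hρ i)
      have h := hsmooth τ k hτ hk q hq (mollify (ρ i) u) (fun j => mollify (ρ i) (F j))
        (cm i lu) s1 (fun j => cm i (lF j)) s2
      have h' : ENNReal.ofReal C
            * smoothCarlemanBound τ k q (mollify (ρ i) u) (fun j => mollify (ρ i) (F j))
          ≤ ENNReal.ofReal C * (2 * carlemanBound τ k f F + ENNReal.ofReal θ) := by
        gcongr
      exact And.intro (h.1.trans h') (And.intro (h.2.1.trans h') (h.2.2.trans h'))
    have t1 : ENNReal.ofReal τ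
          * eLpNorm (fun x => Real.exp (carlemanWeight τ x) * u x) 2 volume
        ≤ ENNReal.ofReal C * (2 * carlemanBound τ k f F + ENNReal.ofReal θ) := by
      rw [ofReal_mul_eLpNorm hτ0]
      refine Lp.eLpNorm_le_of_ae_tendsto (u := atTop)
        (f := fun i x => τ * (Real.exp (carlemanWeight τ x) * mollify (ρ i) u x))
        (hbound.mono fun i hi => ?_) (fun i => ?_) ?_
      · rw [← ofReal_mul_eLpNorm hτ0]
        exact hi.1
      · exact ((mE.mul (cm i lu).continuous.measurable).const_mul τ).aestronglyMeasurable
      · filter_upwards [hlimu] with x hx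
        exact (hx.const_mul _).const_mul _
    have t2 : eLpNorm (fun x => (Real.exp (carlemanWeight τ x) * ‖x‖) • G x) 2 volume
        ≤ ENNReal.ofReal C * (2 * carlemanBound τ k f F + ENNReal.ofReal θ) := by
      refine Lp.eLpNorm_le_of_ae_tendsto (u := atTop)
        (f := fun i x => (Real.exp (carlemanWeight τ x) * ‖x‖) • gradVec (mollify (ρ i) u) x)
        (hbound.mono fun i hi => hi.2.1) (fun i => ?_) ?_
      · exact ((mE.mul measurable_norm).smul
          (continuous_gradVec (cm i lu)).measurable).aestronglyMeasurable
      · filter_upwards [hlimG] with x hx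
        exact hx.const_smul _
    have t3 : ENNReal.ofReal (Real.sqrt τ * k) * eLpNorm (fun x =>
          Real.sqrt (q x) * ‖x‖ * Real.exp (carlemanWeight τ x) * u x) 2 volume
        ≤ ENNReal.ofReal C * (2 * carlemanBound τ k f F + ENNReal.ofReal θ) := by
      have hc0 : 0 ≤ Real.sqrt τ * k := by positivity
      rw [ofReal_mul_eLpNorm hc0]
      refine Lp.eLpNorm_le_of_ae_tendsto (u := atTop)
        (f := fun i x => Real.sqrt τ * k
          * (Real.sqrt (q x) * ‖x‖ * Real.exp (carlemanWeight τ x) * mollify (ρ i) u x))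
        (hbound.mono fun i hi => ?_) (fun i => ?_) ?_
      · rw [← ofReal_mul_eLpNorm hc0]
        exact hi.2.2
      · exact (((((cq.sqrt.measurable).mul measurable_norm).mul mE).mul
          (cm i lu).continuous.measurable).const_mul _).aestronglyMeasurable
      · filter_upwards [hlimu] with x hx
        exact (hx.const_mul _).const_mul _
    calc _ ≤ _ := add_le_add (add_le_add t1 t2) t3
      _ = _ := by ring
  refine ENNReal.le_of_forall_pos_le_add fun η hη _ => ?_
  -- With `θ = η/(3C)` the error `3Cθ` is exactly `η`.
  have hη' : 0 < (η : ℝ) / (3 * C) := by positivity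
  refine (main _ hη').trans (le_of_eq ?_)
  have e1 : ENNReal.ofReal (6 * C) = 6 * ENNReal.ofReal C := by
    rw [ENNReal.ofReal_mul (by norm_num)]
    norm_num
  have e2 : 3 * (ENNReal.ofReal C * ENNReal.ofReal ((η : ℝ) / (3 * C))) = η := by
    rw [← ENNReal.ofReal_mul hC.le, ← ENNReal.ofReal_ofNat, ← ENNReal.ofReal_mul (by norm_num),
      show (OfNat.ofNat 3 : ℝ) * (C * ((η : ℝ) / (3 * C))) = η by field_simp]
    exact ENNReal.ofReal_coe_nnreal
  rw [e1, mul_add, mul_add, e2]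
  ring

end Limit
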